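/- Consider the three-thread program (all accesses relaxed, initially $x=y=r_1=r_2=r_3=0$) $$1{:}\ r_1:=[x];\ 2{:}\ [y]:=r_1+1\quad\big\|\quad 3{:}\ r_2:=[y];\ 4{:}\ [x]:=r_2\quad\big\|\quad 5{:}\ r_3:=[x];\ \textbf{if }r_3=100\textbf{ then }6{:}\ [x]:=99 .$$ Let its event structure be given by the MRD (Modular Relaxed Dependencies) semantics, where reads range over a set of integers $V\supseteq\{0,1,100\}$, and let a *future* of a thread be a maximal conflict-free set of its events, ordered by semantic dependency (each write depends on the reads of a minimal justification) and preserved program order. The operational semantics executes, step by step, an event that is minimal in some remaining future, discards the futures in which it is not available, and updates the C11 graph (sequenced-before, reads-from, modification order), where a thread $t$ reads from, or inserts its write directly after, a write that it can observe (one not modification-order-before a write that $t$ has encountered). Write $[z\not\approx v]_t$ if thread $t$ can observe no write of $v$ to $z$, and $[z=v]_t$ if the only write to $z$ that $t$ can observe is the modification-order-last one and it has value $v$; several thread indices mean the conjunction. Then: 1. The sets of futures are $F=\{\{1_v\prec 2_{v+1}\}\mid v\in V\}$ for thread 1, $G=\{\{3_v\prec 4_v\}\mid v\in V\}$ for thread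 2, and $H=\{\{5_v\}\mid v\in V,\ v\ne 100\}\cup\{\{5_{100}\prec 6\}\}$ for thread 3, where $i_v$ is the event of line $i$ with value $v$. 2. The following proof outline is valid. (The subscript of an assertion is the set of futures of the thread at which it is placed; $F_1,G_3,H_5$ are the sets of futures after the read in line $1,3,5$, and $\emptyset$ means that everything has been executed.) * Thread 1: $\{[y=0]_{2,3}\wedge r_2=0\wedge\forall i\neq 0.\,[x\not\approx i]_1\}_F$; $\{[y=0]_3\wedge r_1=0\}_{F_1}$; $\{\mathit{true}\}_\emptyset$. * Thread 2: $\{[x=0]_{1,2,3}\wedge\forall i\notin\{0,1\}.\,[y\not\approx i]_2\}_G$; $\{[x=0]_{1,2,3}\wedge r_2\in\{0,1\}\}_{G_3}$; $\{\mathit{true}\}_\emptyset$. * Thread 3: $\{(\forall i\notin\{0,1\}.\,[x\not\approx i]_3)\wedge[x\not\approx 99]_{1,2,3}\}_H$; $\{r_3\in\{0,1\}\wedge[x\not\approx 99]_{1,2,3}\}_{H_5}$; inside the conditional $\{\mathit{false}\}_{H_5}$; $\{[x\not\approx 99]_{1,2,3}\}_\emptyset$. Valid means: the initialisation implies all three initial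 assertions; the three final assertions imply $[x\not\approx 99]_{1,2,3}$; every step of a thread from a set of its (sub-)futures at which its assertions hold leads to a set of futures at which its assertions hold (local correctness); and every assertion of a thread is preserved by every step of another thread taken from a state satisfying the assertions of that other thread (global correctness). 3. Every terminating execution from a well-formed state in which the three initial assertions hold ends in a state satisfying $[x\not\approx 99]_{1,2,3}$. 4. In every state reachable from the initialisation the assertions of the outline at the current futures hold, $[x\not\approx 99]_{1,2,3}$ holds, and line 6 cannot be executed. -/

import Mathlib

namespace MRD

/-! ### Syntax -/

abbrev Loc := ℕ
abbrev Reg := ℕ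
abbrev Val := ℤ
abbrev Label := ℕ
/-- Thread identifiers; thread `0` is the initialising thread. -/
abbrev Tid := ℕ
abbrev RegFile := Reg → Val

/-- Read and write actions, carrying the control label of the statement that issues them.
The Boolean marks an acquiring read, respectively a releasing write. -/
inductive Action where
  | rd (acq : Bool) (i : Label) (x : Loc) (v : Val)
  | wr (rel : Bool) (i : Label) (x : Loc) (v : Val)

namespace Action

def isWrite : Action → Prop
  | rd _ _ _ _ => False
  | wr _ _ _ _ => True

def isRead : Action → Prop
  | rd _ _ _ _ => True
  | wr _ _ _ _ => False

def label : Action → Label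
  | rd _ i _ _ => i
  | wr _ i _ _ => i

def loc : Action → Loc
  | rd _ _ x _ => x
  | wr _ _ x _ => x

def val : Action → Val
  | rd _ _ _ v => v
  | wr _ _ _ v => v

def isAcq : Action → Prop
  | rd acq _ _ _ => acq = true
  | wr _ _ _ _ => False

def isRel : Action → Prop
  | rd _ _ _ _ => False
  | wr rel _ _ _ => rel = true

/-- The action without its control label. -/
def eraseLabel : Action → Action
  | rd acq _ x v => rd acq 0 x v
  | wr rel _ x v => wr rel 0 x v

end Action

/-- Atomic commands `i : [x] :=^[R] e` and `i : r :=^[A] [x]`. Expressions are given by their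
evaluation on register files. -/
inductive ACom where
  | store (rel : Bool) (i : Label) (x : Loc) (e : RegFile → Val)
  | load (acq : Bool) (i : Label) (r : Reg) (x : Loc)

def ACom.label : ACom → Label
  | store _ i _ _ => i
  | load _ i _ _ => i

/-- Sequential (loop-free) commands. -/
inductive Com where
  | skip
  | atom (s : ACom)
  | seq (C₁ C₂ : Com)
  | ite (B : RegFile → Bool) (C₁ C₂ : Com)

/-- A parallel program: a function from thread identifiers to commands. Only the threads in
`tids` have code; the others are expected to be `skip`. -/
structure Program where
  tids : Finset Tid
  com : Tid → Com

/-- The atomic set of a command. -/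
def Com.atomicSet : Com → Set ACom
  | skip => ∅
  | atom s => {s}
  | seq C₁ C₂ => C₁.atomicSet ∪ C₂.atomicSet
  | ite _ C₁ C₂ => C₁.atomicSet ∪ C₂.atomicSet

def Program.atomicSet (P : Program) : Tid → Set ACom := fun t => (P.com t).atomicSet

/-! ### Denotational semantics: events, justification, dependency -/

/-- An event of one thread: its label together with the actions that precede it in program
order. Since the event structure of a thread is a tree (it branches at the values returned by
reads), this identifies the event. -/
structure Node where
  past : List Action
  act : Action

/-- Put the action `a` in front of the history of an event. -/
def Node.push (a : Action) (n : Node) : Node := ⟨a :: n.past, n.act⟩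

/-- Strict program order within one thread. -/
def Node.before (m n : Node) : Prop := (m.past ++ [m.act]) <+: n.past

/-- Events of one thread together with the justification relation `C ⊢ e` from sets of
reads to writes. -/
structure ThreadES where
  events : Set Node
  just : Set Node → Node → Prop

def ThreadES.nil : ThreadES := ⟨∅, fun _ _ => False⟩

/-- The access `a` forwards its value to the later read `n`: same location and value, and no
write to that location in between. -/
def Forwards (a : Action) (n : Node) : Prop :=
  n.act.isRead ∧ n.act.loc = a.loc ∧ n.act.val = a.val ∧
    ∀ b ∈ n.past, ¬ (b.isWrite ∧ b.loc = a.loc)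

/-- Prefixing with a write `a`: the write itself needs no justification, and reads that can be
satisfied by store forwarding from `a` are dropped from later justifications. -/
def ThreadES.prefixWrite (a : Action) (G : ThreadES) : ThreadES where
  events := {n | n = ⟨[], a⟩ ∨ ∃ m ∈ G.events, n = m.push a}
  just C n :=
    (n = ⟨[], a⟩ ∧ C = ∅) ∨
    ∃ C' m, G.just C' m ∧ n = m.push a ∧ C = Node.push a '' {c ∈ C' | ¬ Forwards a c}

/-- Two justified writes `C ⊢ m`, `C' ⊢ m'` agree up to control labels. -/
def SameJust (C : Set Node) (m : Node) (C' : Set Node) (m' : Node) : Prop :=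
  m.act.eraseLabel = m'.act.eraseLabel ∧
    (fun c : Node => c.act.eraseLabel) '' C = (fun c : Node => c.act.eraseLabel) '' C'

/-- A read of `x`: the sum over all values `v` in the range `V` of the read event of `v` prefixed
to `G v`. A write that follows the read event is justified by that read event in addition to its
earlier justification (later reads satisfied by load forwarding are dropped). If the write
is available, with the same justification, for *every* value that can be read, it
does not depend on the read and the read is left out of its justification. -/
def ThreadES.readSum (V : Set Val) (acq : Bool) (i : Label) (x : Loc) (G : Val → ThreadES) :
    ThreadES where
  events := {n | ∃ v ∈ V, n = ⟨[], .rd acq i x v⟩ ∨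
    ∃ m ∈ (G v).events, n = m.push (.rd acq i x v)}
  just C n := ∃ v ∈ V, ∃ C' m, (G v).just C' m ∧ n = m.push (.rd acq i x v) ∧
    (C = insert ⟨[], .rd acq i x v⟩
          (Node.push (.rd acq i x v) '' {c ∈ C' | ¬ Forwards (.rd acq i x v) c}) ∨
      ((∀ v' ∈ V, ∃ C'' m', (G v').just C'' m' ∧ SameJust C' m C'' m') ∧
        C = Node.push (.rd acq i x v) '' C'))

/-- Denotation of a command in continuation-passing style. -/
def Com.denote (V : Set Val) : Com → RegFile → (RegFile → ThreadES) → ThreadES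
  | skip, ρ, κ => κ ρ
  | atom (.store rel i x e), ρ, κ => (κ ρ).prefixWrite (.wr rel i x (e ρ))
  | atom (.load acq i r x), ρ, κ =>
      ThreadES.readSum V acq i x (fun v => κ (Function.update ρ r v))
  | seq C₁ C₂, ρ, κ => C₁.denote V ρ (fun ρ' => C₂.denote V ρ' κ)
  | ite B C₁ C₂, ρ, κ => if B ρ then C₁.denote V ρ κ else C₂.denote V ρ κ

abbrev Event := Tid × Node

/-- A partial execution: the set of events, reads-from, and dependency order. (The lock order is
absent since the language has no locks.) -/
structure Execution where
  A : Set Event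
  rf : Event → Event → Prop
  dp : Event → Event → Prop

/-- A coherent event structure. -/
structure CES where
  events : Set Event
  po : Event → Event → Prop
  conflict : Event → Event → Prop
  lab : Event → Action
  execs : Set Execution
  just : Set Event → Event → Prop
  ppo : Event → Event → Prop

/-- Maximal conflict-free sets of events that are closed under program-order predecessors. -/
def IsMaxConfig (E : Set Event) (po conflict : Event → Event → Prop) (A : Set Event) : Prop :=
  A ⊆ E ∧ (∀ a ∈ A, ∀ b ∈ A, ¬ conflict a b) ∧ (∀ a ∈ A, ∀ e ∈ E, po e a → e ∈ A) ∧
    ∀ e ∈ E, (∀ a ∈ A, ¬ conflict e a) → e ∈ A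

def IsMinJust (just : Set Event → Event → Prop) (C : Set Event) (e : Event) : Prop :=
  just C e ∧ ∀ C', just C' e → C' ⊆ C → C' = C

/-- Partial executions: a maximal configuration, a dependency order
obtained by choosing a minimal justification for each write, and a partial reads-from relation
(reads may be unlinked, e.g. if they read an initial value) such that dependency,
preserved program order and reads-from together are acyclic. -/
def IsExecution (E : Set Event) (po conflict : Event → Event → Prop)
    (just : Set Event → Event → Prop) (ppo : Event → Event → Prop) (X : Execution) : Prop :=
  IsMaxConfig E po conflict X.A ∧
  (∃ J : Event → Set Event,
    (∀ w ∈ X.A, w.2.act.isWrite → IsMinJust just (J w) w) ∧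
    ∀ r w, X.dp r w ↔ w ∈ X.A ∧ w.2.act.isWrite ∧ r ∈ J w) ∧
  (∀ w r, X.rf w r → w ∈ X.A ∧ r ∈ X.A ∧ w.2.act.isWrite ∧ r.2.act.isRead ∧
    w.2.act.loc = r.2.act.loc ∧ w.2.act.val = r.2.act.val) ∧
  (∀ w w' r, X.rf w r → X.rf w' r → w = w') ∧
  ∀ e, ¬ Relation.TransGen
    (fun a b => X.rf a b ∨ X.dp a b ∨ (a ∈ X.A ∧ b ∈ X.A ∧ ppo a b)) e e

/-- The denotation of a program, where `V` is the range of values that reads can return. -/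
def Program.denote (V : Set Val) (P : Program) : CES :=
  let th : Tid → ThreadES := fun t => (P.com t).denote V (fun _ => 0) (fun _ => ThreadES.nil)
  let E : Set Event := {e | e.2 ∈ (th e.1).events}
  let po : Event → Event → Prop := fun e e' => e.1 = e'.1 ∧ e.2.before e'.2
  let conflict : Event → Event → Prop := fun e e' =>
    e.1 = e'.1 ∧ e ≠ e' ∧ ¬ e.2.before e'.2 ∧ ¬ e'.2.before e.2
  let just : Set Event → Event → Prop := fun C e =>
    ∃ C', (th e.1).just C' e.2 ∧ C = (fun n => (e.1, n)) '' C'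
  -- preserved: same-location accesses, after an acquiring read, before a releasing write
  let ppo : Event → Event → Prop := fun e e' => po e e' ∧
    (e.2.act.loc = e'.2.act.loc ∨ e.2.act.isAcq ∨ e'.2.act.isRel)
  { events := E
    po := po
    conflict := conflict
    lab := fun e => e.2.act
    execs := {X | IsExecution E po conflict just ppo X}
    just := just
    ppo := ppo }

/-! ### Futures -/

@[ext]
structure Future where
  K : Set Event
  prec : Event → Event → Prop

def Future.restrict (f : Future) (K' : Set Event) : Future :=
  ⟨K', fun a b => a ∈ K' ∧ b ∈ K' ∧ f.prec a b⟩

/-- The future in which every event has been executed. -/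
def Future.done : Future := ⟨∅, fun _ _ => False⟩

/-- The initial futures `(A, dp ∪ ≤|A)` of a coherent event structure. -/
def CES.futures (μ : CES) : Set Future :=
  {f | ∃ X ∈ μ.execs,
    f = ⟨X.A, fun a b => a ∈ X.A ∧ b ∈ X.A ∧ (X.dp a b ∨ μ.ppo a b)⟩}

/-- `a` is available in `f`: some event labelled `a` has no other event of `f` below it. -/
def Available (μ : CES) (a : Action) (f : Future) : Prop :=
  ∃ g ∈ f.K, μ.lab g = a ∧ ∀ g' ∈ f.K, g' ≠ g → ¬ f.prec g' g

/-- `a ▷ f`. -/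
def Future.after (μ : CES) (a : Action) (f : Future) : Future :=
  f.restrict (f.K \ {g | μ.lab g = a})

/-- The candidate futures `a ▷ F`. -/
def candidates (μ : CES) (a : Action) (F : Set Future) : Set Future :=
  {f' | ∃ f ∈ F, Available μ a f ∧ f' = f.after μ a}

/-- `f|t` and `F|t`: restriction to the events of thread `t`. -/
def Future.onThread (f : Future) (t : Tid) : Future := f.restrict {e ∈ f.K | e.1 = t}

def onThread (F : Set Future) (t : Tid) : Set Future := (fun f => f.onThread t) '' F

/-- `F'` is a sub-future of `F`. -/
def SubFuture (F' F : Set Future) : Prop :=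
  ∀ f' ∈ F', ∃ f ∈ F, f'.K ⊆ f.K ∧ (∀ a ∈ f'.K, ∀ b ∈ f.K, f.prec a b → b ∈ f'.K) ∧
    f' = f.restrict f'.K

/-! ### Memory semantics -/

structure TAct where
  tag : ℕ
  act : Action
  tid : Tid

/-- The data of a tagged action graph. -/
structure Graph where
  D : Set TAct
  sb : TAct → TAct → Prop
  rf : TAct → TAct → Prop
  mo : TAct → TAct → Prop

namespace Graph

/-- Well-formedness of a tagged action graph: tags are unique; the relations are over `D`;
`sb` relates actions of one thread or starts in the initialising thread; `rf` relates writes to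
reads of the same location and value; `mo` relates writes to the same
variable and is a strict total order on the writes to each variable. -/
structure WF (σ : Graph) : Prop where
  tag_inj : ∀ a ∈ σ.D, ∀ b ∈ σ.D, a.tag = b.tag → a = b
  sb_dom : ∀ a b, σ.sb a b → a ∈ σ.D ∧ b ∈ σ.D ∧ (a.tid = b.tid ∨ a.tid = 0)
  rf_dom : ∀ a b, σ.rf a b → a ∈ σ.D ∧ b ∈ σ.D ∧ a.act.isWrite ∧ b.act.isRead ∧
    a.act.loc = b.act.loc ∧ a.act.val = b.act.val
  mo_dom : ∀ a b, σ.mo a b → a ∈ σ.D ∧ b ∈ σ.D ∧ a.act.isWrite ∧ b.act.isWrite ∧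
    a.act.loc = b.act.loc
  mo_irrefl : ∀ a, ¬ σ.mo a a
  mo_trans : ∀ a b c, σ.mo a b → σ.mo b c → σ.mo a c
  mo_total : ∀ a ∈ σ.D, ∀ b ∈ σ.D, a.act.isWrite → b.act.isWrite → a.act.loc = b.act.loc →
    a ≠ b → σ.mo a b ∨ σ.mo b a

/-- Happens-before. -/
def hb (σ : Graph) : TAct → TAct → Prop :=
  Relation.TransGen (fun a b => σ.sb a b ∨ (σ.rf a b ∧ a.act.isRel ∧ b.act.isAcq))

/-- From-read. -/
def fr (σ : Graph) (a b : TAct) : Prop := (∃ w, σ.rf w a ∧ σ.mo w b) ∧ a ≠ b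

/-- Extended coherence order. -/
def eco (σ : Graph) : TAct → TAct → Prop :=
  Relation.TransGen (fun a b => σ.rf a b ∨ σ.mo a b ∨ σ.fr a b)

/-- Encountered writes. -/
def EW (σ : Graph) (t : Tid) : Set TAct :=
  {w | w ∈ σ.D ∧ w.act.isWrite ∧ ∃ b ∈ σ.D, b.tid = t ∧
    ∃ c, (w = c ∨ σ.eco w c) ∧ (c = b ∨ σ.hb c b)}

/-- Observable writes. -/
def OW (σ : Graph) (t : Tid) : Set TAct :=
  {w | w ∈ σ.D ∧ w.act.isWrite ∧ ∀ w' ∈ σ.EW t, ¬ σ.mo w w'}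

/-- `sb +_D b`. -/
def sbAdd (σ : Graph) (b : TAct) : TAct → TAct → Prop :=
  fun p q => σ.sb p q ∨ (p ∈ σ.D ∧ (p.tid = b.tid ∨ p.tid = 0) ∧ q = b)

/-- `mo[w, b]`. -/
def moInsert (σ : Graph) (w b : TAct) : TAct → TAct → Prop :=
  fun p q => σ.mo p q ∨ ((p = w ∨ σ.mo p w) ∧ q = b) ∨ (p = b ∧ σ.mo w q)

/-- The memory transitions `σ ⟶[b] σ'`. -/
inductive Step : Graph → TAct → Graph → Prop
  | read (σ : Graph) (b w : TAct) (hfresh : ∀ c ∈ σ.D, c.tag ≠ b.tag) (hb : b.act.isRead)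
      (hw : w ∈ σ.OW b.tid) (hloc : w.act.loc = b.act.loc) (hval : w.act.val = b.act.val) :
      Step σ b ⟨insert b σ.D, σ.sbAdd b, fun p q => σ.rf p q ∨ (p = w ∧ q = b), σ.mo⟩
  | write (σ : Graph) (b w : TAct) (hfresh : ∀ c ∈ σ.D, c.tag ≠ b.tag) (hb : b.act.isWrite)
      (hw : w ∈ σ.OW b.tid) (hloc : w.act.loc = b.act.loc) :
      Step σ b ⟨insert b σ.D, σ.sbAdd b, σ.rf, σ.moInsert w b⟩

end Graph

/-! ### Operational semantics over futures -/

/-- A state configuration: tagged action graph and the register file of each thread. -/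
structure Config where
  σ : Graph
  γ : Tid → RegFile

/-- Thread-local transition `(i : s, γ) ⟶[a]_t (skip, γ')`. -/
inductive LocalStep (t : Tid) (γ : Tid → RegFile) : ACom → Action → (Tid → RegFile) → Prop
  | store (rel : Bool) (i : Label) (x : Loc) (e : RegFile → Val) :
      LocalStep t γ (.store rel i x e) (.wr rel i x (e (γ t))) γ
  | load (acq : Bool) (i : Label) (r : Reg) (x : Loc) (n : Val) :
      LocalStep t γ (.load acq i r x) (.rd acq i x n)
        (Function.update γ t (Function.update (γ t) r n))

structure Sys where
  Q : Tid → Set ACom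
  c : Config
  F : Set Future

/-- A step of the future-based semantics in which thread `t` executes the atomic command `s`. -/
inductive FutureStep (μ : CES) (t : Tid) (s : ACom) : Sys → Sys → Prop
  | mk (Q : Tid → Set ACom) (σ σ' : Graph) (γ γ' : Tid → RegFile) (F : Set Future)
      (g : ℕ) (a : Action) (hs : s ∈ Q t) (ha : (candidates μ a F).Nonempty)
      (hl : LocalStep t γ s a γ') (hm : Graph.Step σ ⟨g, a, t⟩ σ') :
      FutureStep μ t s ⟨Q, ⟨σ, γ⟩, F⟩
        ⟨Function.update Q t (Q t \ {s}), ⟨σ', γ'⟩, candidates μ a F⟩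

/-- One step of the program. -/
def Step (μ : CES) (S S' : Sys) : Prop := ∃ t s, FutureStep μ t s S S'

/-! ### Hoare triples and Owicki-Gries proof outlines -/

abbrev Assertion := Config → Prop
abbrev FuturePred := Set Future → Assertion

/-- `{X} Init; P {Y}`. An execution has terminated when all its futures are fully consumed;
statements in branches that were not taken may then remain in the atomic set. -/
def HoareTriple (V : Set Val) (Init X : Assertion) (P : Program) (Y : Assertion) : Prop :=
  (∀ c, Init c → X c) ∧
  ∀ c Q' c' F', c.σ.WF → X c →
    Relation.ReflTransGen (Step (P.denote V)) ⟨P.atomicSet, c, (P.denote V).futures⟩ ⟨Q', c', F'⟩ →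
    (∀ f ∈ F', f.K = ∅) → Y c'

/-- The sub-program `Q` corresponds to the set of futures `G`: they have the same labels. -/
def Corresponds (μ : CES) (Q : Tid → Set ACom) (G : Set Future) : Prop :=
  {i : Label | ∃ t, ∃ s ∈ Q t, s.label = i} = {i | ∃ f ∈ G, ∃ e ∈ f.K, (μ.lab e).label = i}

/-- The single-step triple `{I}_G Q {I'}`. -/
def StepTriple (μ : CES) (I : FuturePred) (G : Set Future) (Q : Tid → Set ACom)
    (I' : FuturePred) : Prop :=
  ∀ c Q' c' G', c.σ.WF → I G c → Step μ ⟨Q, c, G⟩ ⟨Q', c', G'⟩ → I' G' c'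

/-- `I` is future stable for `(F, Q₀)`. -/
def FutureStable (μ : CES) (I : FuturePred) (F : Set Future) (Q₀ : Tid → Set ACom) : Prop :=
  ∀ G Q, SubFuture G F → (∀ t, Q t ⊆ Q₀ t) → Corresponds μ Q G → StepTriple μ I G Q I

/-- Validity of a proof outline given by one future predicate per thread. -/
structure OutlineValid (V : Set Val) (Init X : Assertion) (P : Program) (I : Tid → FuturePred)
    (Y : Assertion) : Prop where
  init : ∀ c, Init c → X c
  start : ∀ c, c.σ.WF → X c → ∀ t ∈ P.tids, I t (onThread (P.denote V).futures t) c
  finish : ∀ c, c.σ.WF → (∀ t ∈ P.tids, I t {Future.done} c) → Y c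
  localCorrect : ∀ t ∈ P.tids,
    FutureStable (P.denote V) (I t) (onThread (P.denote V).futures t) P.atomicSet
  globalCorrect : ∀ t₁ ∈ P.tids, ∀ t₂ ∈ P.tids, t₁ ≠ t₂ → ∀ F₁ F₂ Q,
    SubFuture F₁ (onThread (P.denote V).futures t₁) →
    SubFuture F₂ (onThread (P.denote V).futures t₂) →
    (∀ t, Q t ⊆ P.atomicSet t) → Corresponds (P.denote V) Q F₂ →
    StepTriple (P.denote V) (fun G c => I t₁ F₁ c ∧ I t₂ G c) F₂ Q (fun _ c => I t₁ F₁ c)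

/-- An assertion `{holds}_G` attached to the sets of futures `G ∈ idx`. -/
structure Annotation where
  idx : Set (Set Future)
  holds : Assertion

/-- The future predicate of an annotated thread: at a set of futures that carries annotations,
all of them; at a set of futures that carries none, `false`. -/
def outlinePred (L : List Annotation) : FuturePred := fun G c =>
  (∃ n ∈ L, G ∈ n.idx) ∧ ∀ n ∈ L, G ∈ n.idx → n.holds c

/-! ### View assertions -/

/-- `[x ≈ v]_t`: thread `t` can observe a write of `v` to `x`. -/
def Possible (x : Loc) (v : Val) (t : Tid) : Assertion := fun c =>
  ∃ w ∈ c.σ.OW t, w.act.loc = x ∧ w.act.val = v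

/-- `[x ≉ v]_t`. -/
def NotPossible (x : Loc) (v : Val) (t : Tid) : Assertion := fun c => ¬ Possible x v t c

/-- `[x = v]_t`: the only write to `x` that thread `t` can observe is the last one in
modification order, and its value is `v`. -/
def Definite (x : Loc) (v : Val) (t : Tid) : Assertion := fun c =>
  ∃ w, {w' ∈ c.σ.OW t | w'.act.loc = x} = {w} ∧ (∀ w', ¬ c.σ.mo w w') ∧ w.act.val = v

/-! ### The RNG litmus test -/

namespace RNG

def x : Loc := 0
def y : Loc := 1
def r1 : Reg := 1
def r2 : Reg := 2
def r3 : Reg := 3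

/-- `6: [x] := 99`. -/
def line6 : ACom := .store false 6 x (fun _ => 99)

def thread1 : Com :=
  .seq (.atom (.load false 1 r1 x)) (.atom (.store false 2 y (fun ρ => ρ r1 + 1)))

def thread2 : Com :=
  .seq (.atom (.load false 3 r2 y)) (.atom (.store false 4 x (fun ρ => ρ r2)))

def thread3 : Com :=
  .seq (.atom (.load false 5 r3 x)) (.ite (fun ρ => decide (ρ r3 = 100)) (.atom line6) .skip)

def prog : Program where
  tids := {1, 2, 3}
  com
    | 1 => thread1
    | 2 => thread2
    | 3 => thread3
    | _ => .skip

/-- The initial graph: one initialising write of `0` for each of `x` and `y`. -/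
def initGraph : Graph where
  D := {⟨0, .wr false 0 x 0, 0⟩, ⟨1, .wr false 0 y 0, 0⟩}
  sb _ _ := False
  rf _ _ := False
  mo _ _ := False

/-- `Init: x = y = r1 = r2 = r3 = 0`. -/
def Init : Assertion := fun c => c.σ = initGraph ∧ c.γ 1 r1 = 0 ∧ c.γ 2 r2 = 0 ∧ c.γ 3 r3 = 0

/-- The initial futures of thread `t`. -/
def futures (V : Set Val) (t : Tid) : Set Future := onThread (prog.denote V).futures t

/-- The futures of thread `t` after its line `i` has read `v` from `z`. -/
def futuresAfterRead (V : Set Val) (t : Tid) (i : Label) (z : Loc) (v : Val) : Set Future :=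
  candidates (prog.denote V) (.rd false i z v) (futures V t)

/-- `[x ≉ 99]_{1,2,3}`. -/
def Post : Assertion := fun c => ∀ t ∈ ({1, 2, 3} : Set Tid), NotPossible x 99 t c

def pre1 : Assertion := fun c =>
  Definite y 0 2 c ∧ Definite y 0 3 c ∧ c.γ 2 r2 = 0 ∧ ∀ i, i ≠ 0 → NotPossible x i 1 c

def pre2 : Assertion := fun c =>
  (∀ t ∈ ({1, 2, 3} : Set Tid), Definite x 0 t c) ∧
    ∀ i, i ∉ ({0, 1} : Set Val) → NotPossible y i 2 c

def pre3 : Assertion := fun c =>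
  (∀ i, i ∉ ({0, 1} : Set Val) → NotPossible x i 3 c) ∧ Post c

def outline1 (V : Set Val) : List Annotation :=
  [ ⟨{futures V 1}, pre1⟩,
    ⟨{G | ∃ v ∈ V, G = futuresAfterRead V 1 1 x v}, fun c => Definite y 0 3 c ∧ c.γ 1 r1 = 0⟩,
    ⟨{{Future.done}}, fun _ => True⟩ ]

def outline2 (V : Set Val) : List Annotation :=
  [ ⟨{futures V 2}, pre2⟩,
    ⟨{G | ∃ v ∈ V, G = futuresAfterRead V 2 3 y v}, fun c =>
      (∀ t ∈ ({1, 2, 3} : Set Tid), Definite x 0 t c) ∧ c.γ 2 r2 ∈ ({0, 1} : Set Val)⟩,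
    ⟨{{Future.done}}, fun _ => True⟩ ]

/-- The third annotation is the one inside the conditional, where line 5 has read `100`. -/
def outline3 (V : Set Val) : List Annotation :=
  [ ⟨{futures V 3}, pre3⟩,
    ⟨{G | ∃ v ∈ V, G = futuresAfterRead V 3 5 x v}, fun c =>
      c.γ 3 r3 ∈ ({0, 1} : Set Val) ∧ Post c⟩,
    ⟨{futuresAfterRead V 3 5 x 100}, fun _ => False⟩,
    ⟨{{Future.done}}, Post⟩ ]

def outline (V : Set Val) : Tid → FuturePred
  | 1 => outlinePred (outline1 V)
  | 2 => outlinePred (outline2 V)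
  | 3 => outlinePred (outline3 V)
  | _ => fun _ _ => True

/-- The precondition of the program: the initial assertions of all threads. -/
def Pre : Assertion := fun c => pre1 c ∧ pre2 c ∧ pre3 c

/-- In thread `t`, a read `a` followed by a write `b` that depends on it: `{a ≺ b}`. -/
def chain (t : Tid) (a b : Action) : Future where
  K := {(t, ⟨[], a⟩), (t, ⟨[a], b⟩)}
  prec e e' := e = (t, ⟨[], a⟩) ∧ e' = (t, ⟨[a], b⟩)

/-- In thread `t`, only the event `a`. -/
def single (t : Tid) (a : Action) : Future := ⟨{(t, ⟨[], a⟩)}, fun _ _ => False⟩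

/-- States reachable from initialisation. -/
def Reachable (V : Set Val) (S : Sys) : Prop :=
  ∃ c, Init c ∧ Relation.ReflTransGen (Step (prog.denote V))
    ⟨prog.atomicSet, c, (prog.denote V).futures⟩ S

end RNG

end MRD

/-! Each write depends on the read before it. The semantics drops a read from a justification only
if the same write is available for every value read. Threads 1 and 2 write an injective function of
the value read, and thread 3 writes nothing after reading `0`, so no read is ever dropped
(`readSum_single`, `threadES_spec`). Hence a future of a thread is given by the value `v` that its
read returns (`branch t v`). Threads choose these values independently, so the futures of the
program form a product over the threads (`futures_prog`, `glue`).

Given the dependencies, no value can go round the cycle between `x` and `y` twice. Until thread 1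
reads, `y` shows thread 2 only `0`, so thread 2 can write only `0` to `x`. Thus thread 1 reads `0`
and writes `1`, thread 2 reads and writes `0` or `1`, and thread 3 reads `0` or `1`, never `100`.
The outline records this. `step_one`, `step_two` and `step_three` extract from it the few actions
possible at each stage, and local and global correctness become a finite case check. The memory side
needs one monotonicity fact: a step makes no write observable except the one it adds
(`Graph.Step.OW_subset`).

For runs of the whole program, labels identify threads, so a step changes a single factor of the
product of futures (`candidates_glued`). The assertions at all factors are therefore an invariant
(`Invariant.step`). Since every assertion of thread 3 contains the postcondition, that holds in
every reachable state. -/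

namespace MRD

namespace RNG

/-! ### The event structure of the program -/

/-- The action by which thread `t` reads `v`. -/
def readAct : Tid → Val → Action
  | 1, v => .rd false 1 x v
  | 2, v => .rd false 3 y v
  | 3, v => .rd false 5 x v
  | _, v => .rd false 0 x v

/-- The write, if any, that thread `t` performs after reading `v`. -/
def writeAct : Tid → Val → Option Action
  | 1, v => some (.wr false 2 y (v + 1))
  | 2, v => some (.wr false 4 x v)
  | 3, v => if v = 100 then some (.wr false 6 x 99) else none
  | _, _ => none

/-- The future of thread `t` in which its read returns `v`. -/
def branch (t : Tid) (v : Val) : Future where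
  -- The condition on `t` makes the branches of idle threads empty, so that values can be chosen for
  -- all thread identifiers uniformly.
  K := {e | t ∈ prog.tids ∧ (e = (t, ⟨[], readAct t v⟩) ∨
    ∃ w ∈ writeAct t v, e = (t, ⟨[readAct t v], w⟩))}
  prec e e' := t ∈ prog.tids ∧ e = (t, ⟨[], readAct t v⟩) ∧
    ∃ w ∈ writeAct t v, e' = (t, ⟨[readAct t v], w⟩)

/-- What is left of `branch t v` after the read. -/
def rest (t : Tid) (v : Val) : Future where
  K := {e | ∃ w ∈ writeAct t v, e = (t, ⟨[readAct t v], w⟩)}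
  prec _ _ := False

theorem mem_tids {t : Tid} : t ∈ prog.tids ↔ t = 1 ∨ t = 2 ∨ t = 3 := by
  simp [prog]

theorem readAct_injective (t : Tid) : Function.Injective (readAct t) := by
  intro v v' h
  unfold readAct at h
  split at h <;> simpa using h

theorem not_isWrite_readAct (t : Tid) (v : Val) : ¬ (readAct t v).isWrite := by
  unfold readAct
  split <;> exact fun h => h

theorem isWrite_of_mem_writeAct {t : Tid} {v : Val} {w : Action} (h : w ∈ writeAct t v) :
    w.isWrite := by
  unfold writeAct at h
  split at h
  · simp at h; subst h; trivial
  · simp at h; subst h; trivial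
  · simp at h; rw [← h.2]; trivial
  · simp at h

theorem readAct_ne_of_mem_writeAct {t : Tid} {v v' : Val} {w : Action} (h : w ∈ writeAct t v) :
    readAct t v' ≠ w := by
  rintro rfl
  exact not_isWrite_readAct t v' (isWrite_of_mem_writeAct h)

/-- Events and justifications of a read whose continuation performs at most one write, where
the write is not available for every value. -/
theorem readSum_single {V : Set Val} {i : Label} {z : Loc} {W : Val → Option Action}
    (hW : ∀ v ∈ V, ∀ w ∈ W v, ∃ v' ∈ V, ∀ w' ∈ W v', w.eraseLabel ≠ w'.eraseLabel)
    {G : Val → ThreadES}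
    (hGe : ∀ v n, n ∈ (G v).events ↔ ∃ w ∈ W v, n = ⟨[], w⟩)
    (hGj : ∀ v C n, (G v).just C n ↔ ∃ w ∈ W v, n = ⟨[], w⟩ ∧ C = ∅) :
    (∀ n, n ∈ (ThreadES.readSum V false i z G).events ↔ ∃ v ∈ V, n = ⟨[], .rd false i z v⟩ ∨
      ∃ w ∈ W v, n = ⟨[.rd false i z v], w⟩) ∧
    (∀ C n, (ThreadES.readSum V false i z G).just C n ↔ ∃ v ∈ V, ∃ w ∈ W v,
      n = ⟨[.rd false i z v], w⟩ ∧ C = {⟨[], .rd false i z v⟩}) := by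
  constructor
  · intro n
    simp only [ThreadES.readSum, Set.mem_ofPred_eq, hGe]
    refine exists_congr fun v => and_congr_right fun _ => or_congr_right ?_
    constructor
    · rintro ⟨m, ⟨w, hw, rfl⟩, rfl⟩
      exact ⟨w, hw, rfl⟩
    · rintro ⟨w, hw, rfl⟩
      exact ⟨_, ⟨w, hw, rfl⟩, rfl⟩
  · intro C n
    simp only [ThreadES.readSum, hGj]
    refine exists_congr fun v => and_congr_right fun hv => ?_
    constructor
    · rintro ⟨C', m, ⟨w, hw, rfl, rfl⟩, rfl, hC | ⟨hall, -⟩⟩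
      · exact ⟨w, hw, rfl, by simpa using hC⟩
      -- Leaving out the read would require an equal write, up to labels, at the value `v'` as well,
      -- and `hW` rules this out.
      · obtain ⟨v', hv', hne⟩ := hW v hv w hw
        obtain ⟨C'', m', ⟨w', hw', rfl, rfl⟩, hs, -⟩ := hall v' hv'
        exact absurd hs (hne w' hw')
    · rintro ⟨w, hw, rfl, rfl⟩
      exact ⟨∅, ⟨[], w⟩, ⟨w, hw, rfl, rfl⟩, rfl, Or.inl (by simp)⟩

theorem prefixWrite_nil_events (a : Action) (n : Node) :
    n ∈ (ThreadES.nil.prefixWrite a).events ↔ n = ⟨[], a⟩ := by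
  simp [ThreadES.prefixWrite, ThreadES.nil]

theorem prefixWrite_nil_just (a : Action) (C : Set Node) (n : Node) :
    (ThreadES.nil.prefixWrite a).just C n ↔ n = ⟨[], a⟩ ∧ C = ∅ := by
  simp [ThreadES.prefixWrite, ThreadES.nil]

/-- The event structure of thread `t`. -/
def threadES (V : Set Val) (t : Tid) : ThreadES :=
  (prog.com t).denote V (fun _ => 0) (fun _ => ThreadES.nil)

theorem threadES_spec {V : Set Val} (hV : {0, 1, 100} ⊆ V) {t : Tid} (ht : t ∈ prog.tids) :
    (∀ n, n ∈ (threadES V t).events ↔ ∃ v ∈ V, n = ⟨[], readAct t v⟩ ∨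
      ∃ w ∈ writeAct t v, n = ⟨[readAct t v], w⟩) ∧
    (∀ C n, (threadES V t).just C n ↔ ∃ v ∈ V, ∃ w ∈ writeAct t v,
      n = ⟨[readAct t v], w⟩ ∧ C = {⟨[], readAct t v⟩}) := by
  have h0 : (0 : Val) ∈ V := hV (by simp)
  have h1 : (1 : Val) ∈ V := hV (by simp)
  obtain rfl | rfl | rfl := mem_tids.1 ht
  · refine readSum_single (W := writeAct 1) ?_ ?_ ?_
    · rintro v - w hw
      obtain rfl : Action.wr false 2 y (v + 1) = w := by simpa [writeAct] using hw
      -- The written value is injective in the value read, so whichever of `0` and `1` differs from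
      -- `v` witnesses the dependency.
      by_cases hv : v = 0
      · exact ⟨1, h1, by simp [writeAct, Action.eraseLabel, hv]⟩
      · exact ⟨0, h0, by simp [writeAct, Action.eraseLabel, hv]⟩
    · intro v n
      simp [writeAct, Com.denote, prefixWrite_nil_events]
    · intro v C n
      simp [writeAct, Com.denote, prefixWrite_nil_just]
  · refine readSum_single (W := writeAct 2) ?_ ?_ ?_
    · rintro v - w hw
      obtain rfl : Action.wr false 4 x v = w := by simpa [writeAct] using hw
      by_cases hv : v = 0
      · exact ⟨1, h1, by simp [writeAct, Action.eraseLabel, hv]⟩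
      · exact ⟨0, h0, by simp [writeAct, Action.eraseLabel, hv]⟩
    · intro v n
      simp [writeAct, Com.denote, prefixWrite_nil_events]
    · intro v C n
      simp [writeAct, Com.denote, prefixWrite_nil_just]
  · refine readSum_single (W := writeAct 3) ?_ ?_ ?_
    · rintro v - w -
      exact ⟨0, h0, by simp [writeAct]⟩
    · intro v n
      by_cases hv : v = 100
      · simp [writeAct, Com.denote, line6, prefixWrite_nil_events, hv]
      · simp [writeAct, Com.denote, ThreadES.nil, hv]
    · intro v C n
      by_cases hv : v = 100
      · simp [writeAct, Com.denote, line6, prefixWrite_nil_just, hv]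
      · simp [writeAct, Com.denote, ThreadES.nil, hv]

theorem threadES_of_notMem {V : Set Val} {t : Tid} (ht : t ∉ prog.tids) :
    threadES V t = ThreadES.nil := by
  have : prog.com t = .skip := by
    rw [mem_tids] at ht
    simp only [prog]
    split <;> simp_all
  simp [threadES, this, Com.denote]

theorem mem_events {V : Set Val} (hV : {0, 1, 100} ⊆ V) {e : Event} :
    e ∈ (prog.denote V).events ↔ ∃ v ∈ V, e ∈ (branch e.1 v).K := by
  change e.2 ∈ (threadES V e.1).events ↔ _
  obtain ⟨t, n⟩ := e
  by_cases ht : t ∈ prog.tids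
  · simp [(threadES_spec hV ht).1, branch, ht]
  · simp [threadES_of_notMem ht, branch, ht, ThreadES.nil]

theorem just_iff {V : Set Val} (hV : {0, 1, 100} ⊆ V) {C : Set Event} {e : Event} :
    (prog.denote V).just C e ↔ e.1 ∈ prog.tids ∧ ∃ v ∈ V, ∃ w ∈ writeAct e.1 v,
      e = (e.1, ⟨[readAct e.1 v], w⟩) ∧ C = {(e.1, ⟨[], readAct e.1 v⟩)} := by
  change (∃ C', (threadES V e.1).just C' e.2 ∧ C = (fun n => (e.1, n)) '' C') ↔ _
  obtain ⟨t, n⟩ := e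
  by_cases ht : t ∈ prog.tids
  · simp only [(threadES_spec hV ht).2, ht, true_and]
    constructor
    · rintro ⟨C', ⟨v, hv, w, hw, rfl, rfl⟩, rfl⟩
      exact ⟨v, hv, w, hw, rfl, by simp⟩
    · rintro ⟨v, hv, w, hw, hn, rfl⟩
      exact ⟨_, ⟨v, hv, w, hw, (Prod.mk.inj hn).2, rfl⟩, by simp⟩
  · simp [threadES_of_notMem ht, ht, ThreadES.nil]

theorem not_before_root (m : Node) (a : Action) : ¬ m.before ⟨[], a⟩ := by
  simp [Node.before]

theorem before_singleton_iff (m : Node) (a b : Action) :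
    m.before ⟨[a], b⟩ ↔ m = ⟨[], a⟩ := by
  obtain ⟨p, c⟩ := m
  cases p with
  | nil => simp [Node.before]
  | cons d p => simp [Node.before]

theorem fst_of_mem_branch {t : Tid} {v : Val} {e : Event} (h : e ∈ (branch t v).K) : e.1 = t := by
  obtain ⟨-, rfl | ⟨w, -, rfl⟩⟩ := h <;> rfl

/-- The only program-order pair in a branch is the read and its write, which is already a
dependency. Preserved program order therefore adds nothing to the order of a future. -/
theorem po_branch_iff {t : Tid} {v : Val} {e e' : Event} (h' : e' ∈ (branch t v).K) :
    (e.1 = e'.1 ∧ e.2.before e'.2) ↔ (branch t v).prec e e' := by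
  obtain ⟨ht, rfl | ⟨w, hw, rfl⟩⟩ := h'
  · constructor
    · exact fun h => absurd h.2 (not_before_root _ _)
    · rintro ⟨-, -, w, -, h⟩
      simp at h
  · rw [before_singleton_iff]
    constructor
    · rintro ⟨h1, h2⟩
      exact ⟨ht, Prod.ext h1 h2, w, hw, rfl⟩
    · rintro ⟨-, rfl, -⟩
      exact ⟨rfl, rfl⟩

/-! ### Gluing futures of different threads -/

/-- The juxtaposition of futures, one for each thread. -/
def glue (φ : Tid → Future) : Future where
  K := {e | ∃ t, e ∈ (φ t).K}
  prec e e' := ∃ t, (φ t).prec e e'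

/-- All juxtapositions of futures from given sets. -/
def glued (Φ : Tid → Set Future) : Set Future := {f | ∃ φ, (∀ t, φ t ∈ Φ t) ∧ f = glue φ}

theorem mem_glue_branch {ν : Tid → Val} {e : Event} :
    e ∈ (glue fun t => branch t (ν t)).K ↔ e ∈ (branch e.1 (ν e.1)).K := by
  constructor
  · rintro ⟨t, ht⟩
    obtain rfl := fst_of_mem_branch ht
    exact ht
  · exact fun h => ⟨_, h⟩

/-! ### Conflict and maximal configurations -/

theorem root_mem_branch {t : Tid} (ht : t ∈ prog.tids) (v : Val) :
    ((t, ⟨[], readAct t v⟩) : Event) ∈ (branch t v).K := ⟨ht, Or.inl rfl⟩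

theorem root_mem_events {V : Set Val} (hV : {0, 1, 100} ⊆ V) {t : Tid} (ht : t ∈ prog.tids)
    {v : Val} (hv : v ∈ V) : ((t, ⟨[], readAct t v⟩) : Event) ∈ (prog.denote V).events :=
  (mem_events hV).2 ⟨v, hv, root_mem_branch ht v⟩

/-- Two events of one branch are not in conflict. -/
theorem not_conflict_of_mem_branch {V : Set Val} {t : Tid} {v : Val} {e e' : Event}
    (h : e ∈ (branch t v).K) (h' : e' ∈ (branch t v).K) : ¬ (prog.denote V).conflict e e' := by
  rintro ⟨-, hne, hb, hb'⟩
  obtain ⟨-, rfl | ⟨w, hw, rfl⟩⟩ := h <;> obtain ⟨-, rfl | ⟨w', hw', rfl⟩⟩ := h'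
  · exact hne rfl
  · exact hb ((before_singleton_iff _ _ _).2 rfl)
  · exact hb' ((before_singleton_iff _ _ _).2 rfl)
  · exact hne (by rw [Option.mem_unique hw hw'])

/-- An event that is not in conflict with the read of `v` belongs to the branch of `v`. -/
theorem mem_branch_of_not_conflict {V : Set Val} {t : Tid} {v v' : Val} {e : Event}
    (h : e ∈ (branch t v').K)
    (hc : ¬ (prog.denote V).conflict e (t, ⟨[], readAct t v⟩)) : e ∈ (branch t v).K := by
  have hv : v' = v := by
    by_contra hne
    refine hc ⟨fst_of_mem_branch h, ?_, not_before_root _ _, ?_⟩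
    · rintro rfl
      obtain ⟨-, h | ⟨w, -, h⟩⟩ := h
      · exact hne (readAct_injective t (by simpa using h)).symm
      · simp at h
    · obtain ⟨-, rfl | ⟨w, -, rfl⟩⟩ := h
      · exact not_before_root _ _
      · rw [before_singleton_iff]
        intro h
        exact hne (readAct_injective t (by simpa using h)).symm
  rwa [hv] at h

theorem root_mem_of_isMaxConfig {V : Set Val} (hV : {0, 1, 100} ⊆ V) {A : Set Event}
    (hA : IsMaxConfig (prog.denote V).events (prog.denote V).po (prog.denote V).conflict A)
    {t : Tid} {v : Val} (hv : v ∈ V) {e : Event} (he : e ∈ A) (heb : e ∈ (branch t v).K) :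
    ((t, ⟨[], readAct t v⟩) : Event) ∈ A := by
  obtain ⟨ht, rfl | ⟨w, hw, rfl⟩⟩ := heb
  · exact he
  · exact hA.2.2.1 _ he _ (root_mem_events hV ht hv) ⟨rfl, (before_singleton_iff _ _ _).2 rfl⟩

/-- The maximal configurations choose one value for each thread. -/
theorem isMaxConfig_iff {V : Set Val} (hV : {0, 1, 100} ⊆ V) {A : Set Event} :
    IsMaxConfig (prog.denote V).events (prog.denote V).po (prog.denote V).conflict A ↔
      ∃ ν : Tid → Val, (∀ t, ν t ∈ V) ∧ A = (glue fun t => branch t (ν t)).K := by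
  have h0 : (0 : Val) ∈ V := hV (by simp)
  constructor
  · intro hA
    have key : ∀ t, ∃ v ∈ V, ∀ e : Event, e.1 = t → (e ∈ A ↔ e ∈ (branch t v).K) := by
      intro t
      by_cases ht : t ∈ prog.tids
      · obtain ⟨v, hv, hvA⟩ : ∃ v ∈ V, ((t, ⟨[], readAct t v⟩) : Event) ∈ A := by
          -- If `A` contained no read of thread `t`, then by downward closure it would contain no
          -- event of `t` at all. The read of `0` would then conflict with nothing in `A`, and
          -- maximality would put it into `A`.
          by_contra! hcon
          refine hcon 0 h0 (hA.2.2.2 _ (root_mem_events hV ht h0) fun a ha hc => ?_)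
          obtain ⟨v, hv, hab⟩ := (mem_events hV).1 (hA.1 ha)
          obtain rfl : t = a.1 := hc.1
          exact hcon v hv (root_mem_of_isMaxConfig hV hA hv ha hab)
        have hsub : ∀ e : Event, e.1 = t → e ∈ A → e ∈ (branch t v).K := by
          rintro e rfl he
          obtain ⟨v', -, heb⟩ := (mem_events hV).1 (hA.1 he)
          exact mem_branch_of_not_conflict heb (hA.2.1 _ he _ hvA)
        refine ⟨v, hv, fun e het => ⟨hsub e het, fun he => ?_⟩⟩
        refine hA.2.2.2 e ((mem_events hV).2 ⟨v, hv, by rwa [het]⟩) fun a ha hc => ?_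
        exact not_conflict_of_mem_branch he (hsub a (hc.1.symm.trans het) ha) hc
      -- An idle thread has no events, so any value serves.
      · refine ⟨0, h0, fun e het => ⟨fun he => ?_, fun he => absurd he.1 ht⟩⟩
        obtain ⟨v, -, heb⟩ := (mem_events hV).1 (hA.1 he)
        exact absurd (het ▸ heb.1) ht
    choose ν hν hA' using key
    refine ⟨ν, hν, Set.ext fun e => ?_⟩
    rw [mem_glue_branch]
    exact hA' e.1 e rfl
  · rintro ⟨ν, hν, rfl⟩
    refine ⟨fun e he => ?_, fun a ha b hb hc => ?_, fun a ha e _ hpo => ?_, fun e he hc => ?_⟩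
    · exact (mem_events hV).2 ⟨_, hν e.1, mem_glue_branch.1 he⟩
    · rw [mem_glue_branch] at ha hb
      rw [← hc.1] at hb
      exact not_conflict_of_mem_branch ha hb hc
    · rw [mem_glue_branch] at ha
      obtain ⟨ht, rfl, -⟩ := (po_branch_iff ha).1 hpo
      exact ⟨_, root_mem_branch ht _⟩
    · obtain ⟨v, -, heb⟩ := (mem_events hV).1 he
      rw [mem_glue_branch]
      exact mem_branch_of_not_conflict heb (hc _ ⟨_, root_mem_branch heb.1 _⟩)

/-! ### Executions and futures of the program -/

/-- The growing length of the history is a rank for the order; it yields the acyclicity required of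
executions. -/
theorem mem_glue_of_prec {ν : Tid → Val} {e e' : Event}
    (h : (glue fun t => branch t (ν t)).prec e e') :
    e ∈ (glue fun t => branch t (ν t)).K ∧ e' ∈ (glue fun t => branch t (ν t)).K ∧
      e'.2.act.isWrite ∧ e.2.past.length < e'.2.past.length := by
  obtain ⟨t, ht, rfl, w, hw, rfl⟩ := h
  exact ⟨⟨t, ht, Or.inl rfl⟩, ⟨t, ht, Or.inr ⟨w, hw, rfl⟩⟩, isWrite_of_mem_writeAct hw, by simp⟩

/-- The only justification of a write of the configuration. -/
theorem just_iff_of_mem_glue {V : Set Val} (hV : {0, 1, 100} ⊆ V) {ν : Tid → Val}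
    (hν : ∀ t, ν t ∈ V) {e : Event} (he : e ∈ (glue fun t => branch t (ν t)).K)
    (hw : e.2.act.isWrite) {C : Set Event} :
    (prog.denote V).just C e ↔ C = {e' | (glue fun t => branch t (ν t)).prec e' e} := by
  obtain ⟨t, ht, rfl | ⟨w, hwt, rfl⟩⟩ := he
  · exact absurd hw (not_isWrite_readAct _ _)
  · have : {e' : Event | (glue fun t => branch t (ν t)).prec e' (t, ⟨[readAct t (ν t)], w⟩)}
        = {(t, ⟨[], readAct t (ν t)⟩)} := by
      ext e'
      constructor
      · rintro ⟨t', ht', rfl, w', hw', h⟩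
        obtain rfl : t = t' := (Prod.mk.inj h).1
        rfl
      · rintro rfl
        exact ⟨t, ht, rfl, w, hwt, rfl⟩
    rw [just_iff hV, this]
    constructor
    · rintro ⟨-, v, -, w', -, h, rfl⟩
      have : readAct t (ν t) = readAct t v ∧ w = w' := by simpa using h
      rw [this.1]
    · rintro rfl
      exact ⟨ht, ν t, hν t, w, hwt, rfl, rfl⟩

theorem po_glue {ν : Tid → Val} {e e' : Event}
    (h' : e' ∈ (glue fun t => branch t (ν t)).K) (h : e.1 = e'.1 ∧ e.2.before e'.2) :
    (glue fun t => branch t (ν t)).prec e e' :=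
  ⟨_, (po_branch_iff (mem_glue_branch.1 h')).1 h⟩

/-- The futures of the program. -/
theorem futures_prog {V : Set Val} (hV : {0, 1, 100} ⊆ V) :
    (prog.denote V).futures =
      {f | ∃ ν : Tid → Val, (∀ t, ν t ∈ V) ∧ f = glue fun t => branch t (ν t)} := by
  ext f
  constructor
  · rintro ⟨X, ⟨hmax, ⟨J, hJ, hdp⟩, -⟩, rfl⟩
    obtain ⟨ν, hν, hA⟩ := (isMaxConfig_iff hV).1 hmax
    -- A write has exactly one justification, so the choice `J` is forced and the dependency order
    -- is that of the glued branches.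
    have hJ' : ∀ w ∈ X.A, w.2.act.isWrite →
        J w = {e' | (glue fun t => branch t (ν t)).prec e' w} := fun w hw hww =>
      (just_iff_of_mem_glue hV hν (hA ▸ hw) hww).1 (hJ w hw hww).1
    refine ⟨ν, hν, Future.ext hA ?_⟩
    funext a b
    refine propext ⟨?_, fun h => ?_⟩
    · rintro ⟨-, hb, h | h⟩
      · obtain ⟨hw, hww, hr⟩ := (hdp _ _).1 h
        rw [hJ' _ hw hww] at hr
        exact hr
      · exact po_glue (hA ▸ hb) h.1
    · obtain ⟨ha, hb, hw, -⟩ := mem_glue_of_prec h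
      rw [← hA] at ha hb
      refine ⟨ha, hb, Or.inl ((hdp _ _).2 ⟨hb, hw, ?_⟩)⟩
      rw [hJ' _ hb hw]
      exact h
  · rintro ⟨ν, hν, rfl⟩
    set g := glue fun t => branch t (ν t)
    -- Partial executions may leave reads unlinked, so the empty reads-from relation suffices and
    -- cannot create a cycle.
    refine ⟨⟨g.K, fun _ _ => False, g.prec⟩, ⟨(isMaxConfig_iff hV).2 ⟨ν, hν, rfl⟩,
      ⟨fun w => {e | g.prec e w}, fun w hw hww => ⟨?_, fun C' hC' _ => ?_⟩, fun r w => ?_⟩,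
      fun _ _ h => h.elim, fun _ _ _ h => h.elim, fun e he => ?_⟩, ?_⟩
    · exact (just_iff_of_mem_glue hV hν hw hww).2 rfl
    · exact (just_iff_of_mem_glue hV hν hw hww).1 hC'
    · exact ⟨fun h => ⟨(mem_glue_of_prec h).2.1, (mem_glue_of_prec h).2.2.1, h⟩, fun h => h.2.2⟩
    · have hlt : ∀ e', Relation.TransGen (fun a b => False ∨ g.prec a b ∨
          (a ∈ g.K ∧ b ∈ g.K ∧ (prog.denote V).ppo a b)) e e' →
          e.2.past.length < e'.2.past.length := by
        have hstep : ∀ a b, (False ∨ g.prec a b ∨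
            (a ∈ g.K ∧ b ∈ g.K ∧ (prog.denote V).ppo a b)) →
            a.2.past.length < b.2.past.length := by
          rintro a b (h | h | ⟨-, hb, h⟩)
          · exact h.elim
          · exact (mem_glue_of_prec h).2.2.2
          · exact (mem_glue_of_prec (po_glue hb h.1)).2.2.2
        intro e' h
        induction h with
        | single h => exact hstep _ _ h
        | tail _ h ih => exact ih.trans (hstep _ _ h)
      exact lt_irrefl _ (hlt e he)
    · refine Future.ext rfl ?_
      funext a b
      refine propext ⟨fun h => ?_, ?_⟩
      · exact ⟨(mem_glue_of_prec h).1, (mem_glue_of_prec h).2.1, Or.inl h⟩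
      · rintro ⟨-, hb, h | h⟩
        · exact h
        · exact po_glue hb h.1

/-- `f` involves only events of thread `t`. -/
structure IsLocal (t : Tid) (f : Future) : Prop where
  fst_eq : ∀ e ∈ f.K, e.1 = t
  mem_of_prec : ∀ a b, f.prec a b → a ∈ f.K ∧ b ∈ f.K

theorem isLocal_branch (t : Tid) (v : Val) : IsLocal t (branch t v) where
  fst_eq _ := fst_of_mem_branch
  mem_of_prec := by
    rintro a b ⟨ht, rfl, w, hw, rfl⟩
    exact ⟨⟨ht, Or.inl rfl⟩, ht, Or.inr ⟨w, hw, rfl⟩⟩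

/-- Locality makes the components disjoint, so each can be recovered from the whole. -/
theorem onThread_glue {φ : Tid → Future} (hφ : ∀ t, IsLocal t (φ t)) (t : Tid) :
    (glue φ).onThread t = φ t := by
  refine Future.ext (Set.ext fun e => ?_) ?_
  · constructor
    · rintro ⟨⟨t', h⟩, rfl⟩
      rwa [(hφ t').fst_eq e h]
    · exact fun h => ⟨⟨t, h⟩, (hφ t).fst_eq e h⟩
  · funext a b
    refine propext ⟨?_, fun h => ?_⟩
    · rintro ⟨⟨⟨t', -⟩, rfl⟩, -, t'', h⟩
      have := (hφ t'').fst_eq a ((hφ t'').mem_of_prec a b h).1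
      rwa [this]
    · obtain ⟨ha, hb⟩ := (hφ t).mem_of_prec a b h
      exact ⟨⟨⟨t, ha⟩, (hφ t).fst_eq a ha⟩, ⟨⟨t, hb⟩, (hφ t).fst_eq b hb⟩, t, h⟩

/-- The futures of a single thread. -/
theorem futures_eq {V : Set Val} (hV : {0, 1, 100} ⊆ V) (t : Tid) :
    futures V t = {f | ∃ v ∈ V, f = branch t v} := by
  ext f
  rw [futures, futures_prog hV]
  constructor
  · rintro ⟨_, ⟨ν, hν, rfl⟩, rfl⟩
    exact ⟨ν t, hν t, onThread_glue (fun t => isLocal_branch t (ν t)) t⟩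
  · rintro ⟨v, hv, rfl⟩
    exact ⟨_, ⟨fun _ => v, fun _ => hv, rfl⟩, onThread_glue (fun t => isLocal_branch t v) t⟩

/-- The values read by different threads are chosen independently. This product form is the starting
point of the run invariant. -/
theorem futures_prog_eq_glued {V : Set Val} (hV : {0, 1, 100} ⊆ V) :
    (prog.denote V).futures = glued (futures V) := by
  rw [futures_prog hV]
  ext f
  simp only [glued, futures_eq hV, Set.mem_ofPred_eq]
  constructor
  · rintro ⟨ν, hν, rfl⟩
    exact ⟨_, fun t => ⟨ν t, hν t, rfl⟩, rfl⟩
  · rintro ⟨φ, hφ, rfl⟩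
    choose ν hν hφ using hφ
    exact ⟨ν, hν, congrArg glue (funext hφ)⟩

theorem branch_eq_chain {t : Tid} (ht : t ∈ prog.tids) {v : Val} {w : Action}
    (hw : writeAct t v = some w) : branch t v = chain t (readAct t v) w := by
  refine Future.ext (Set.ext fun e => ?_) ?_
  · simp [branch, chain, ht, hw]
  · funext a b
    simp [branch, chain, ht, hw]

theorem branch_eq_single {t : Tid} (ht : t ∈ prog.tids) {v : Val}
    (hw : writeAct t v = none) : branch t v = single t (readAct t v) := by
  refine Future.ext (Set.ext fun e => ?_) ?_
  · simp [branch, single, ht, hw]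
  · funext a b
    simp [branch, single, hw]

theorem futures_one {V : Set Val} (hV : {0, 1, 100} ⊆ V) : futures V 1 =
    {f | ∃ v ∈ V, f = chain 1 (.rd false 1 x v) (.wr false 2 y (v + 1))} := by
  rw [futures_eq hV]
  simp_rw [branch_eq_chain (t := 1) (by simp [prog]) rfl]
  rfl

theorem futures_two {V : Set Val} (hV : {0, 1, 100} ⊆ V) : futures V 2 =
    {f | ∃ v ∈ V, f = chain 2 (.rd false 3 y v) (.wr false 4 x v)} := by
  rw [futures_eq hV]
  simp_rw [branch_eq_chain (t := 2) (by simp [prog]) rfl]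
  rfl

theorem futures_three {V : Set Val} (hV : {0, 1, 100} ⊆ V) : futures V 3 =
    {f | (∃ v ∈ V, v ≠ 100 ∧ f = single 3 (.rd false 5 x v)) ∨
      f = chain 3 (.rd false 5 x 100) (.wr false 6 x 99)} := by
  have h3 : 3 ∈ prog.tids := by simp [prog]
  have h100 : branch 3 100 = chain 3 (.rd false 5 x 100) (.wr false 6 x 99) :=
    branch_eq_chain h3 (by simp [writeAct])
  have hne : ∀ v : Val, v ≠ 100 → branch 3 v = single 3 (.rd false 5 x v) := fun v hv =>
    branch_eq_single h3 (by simp [writeAct, hv])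
  rw [futures_eq hV]
  ext f
  constructor
  · rintro ⟨v, hv, rfl⟩
    by_cases h : v = 100
    · subst h
      exact Or.inr h100
    · exact Or.inl ⟨v, hv, h, hne v h⟩
  · rintro (⟨v, hv, h, rfl⟩ | rfl)
    · exact ⟨v, hv, (hne v h).symm⟩
    · exact ⟨100, hV (by simp), h100.symm⟩

end RNG

end MRD

namespace MRD

/-! ### Stability of view assertions -/

/-- Happens-before, from-read and extended coherence are built positively from `sb`, `rf` and `mo`,
so enlarging these can only add encountered writes. -/
theorem Graph.EW_mono {σ σ' : Graph} (hD : σ.D ⊆ σ'.D) (hsb : ∀ p q, σ.sb p q → σ'.sb p q)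
    (hrf : ∀ p q, σ.rf p q → σ'.rf p q) (hmo : ∀ p q, σ.mo p q → σ'.mo p q) (t : Tid) :
    σ.EW t ⊆ σ'.EW t := by
  rintro w ⟨hw, hww, b, hb, hbt, c, hwc, hcb⟩
  refine ⟨hD hw, hww, b, hD hb, hbt, c, hwc.imp_right fun h => ?_, hcb.imp_right fun h => ?_⟩
  · refine Relation.TransGen.mono (fun p q hpq => ?_) _ _ h
    exact hpq.imp (hrf _ _) (Or.imp (hmo _ _)
      fun ⟨⟨u, hu, hu'⟩, hne⟩ => ⟨⟨u, hrf _ _ hu, hmo _ _ hu'⟩, hne⟩)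
  · refine Relation.TransGen.mono (fun p q hpq => ?_) _ _ h
    exact hpq.imp (hsb _ _) fun h => ⟨hrf _ _ h.1, h.2⟩

namespace Graph.Step

variable {σ σ' : Graph} {b : TAct}

theorem notMem (h : Graph.Step σ b σ') : b ∉ σ.D := by
  cases h with
  | read w hfresh => exact fun h => hfresh b h rfl
  | write w hfresh => exact fun h => hfresh b h rfl

theorem D_eq (h : Graph.Step σ b σ') : σ'.D = insert b σ.D := by
  cases h <;> rfl

theorem mo_le (h : Graph.Step σ b σ') : ∀ p q, σ.mo p q → σ'.mo p q := by
  cases h with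
  | read => exact fun _ _ h => h
  | write => exact fun _ _ h => Or.inl h

theorem EW_subset (h : Graph.Step σ b σ') (t : Tid) : σ.EW t ⊆ σ'.EW t := by
  refine Graph.EW_mono (h.D_eq ▸ Set.subset_insert _ _) ?_ ?_ h.mo_le t
  · cases h <;> exact fun _ _ h => Or.inl h
  · cases h with
    | read => exact fun _ _ h => Or.inl h
    | write => exact fun _ _ h => h

/-- A step makes no write observable except the one it adds. -/
theorem OW_subset (h : Graph.Step σ b σ') {t : Tid} {w : TAct} (hw : w ∈ σ'.OW t) :
    w ∈ σ.OW t ∨ (b.act.isWrite ∧ w = b) := by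
  obtain ⟨hD, hww, hobs⟩ := hw
  rw [h.D_eq] at hD
  obtain rfl | hD := hD
  · exact Or.inr ⟨hww, rfl⟩
  · exact Or.inl ⟨hD, hww, fun w' hw' hmo => hobs w' (h.EW_subset t hw') (h.mo_le _ _ hmo)⟩

/-- The write read from is observable before the step. This turns the assertions on observable
values into bounds on what a read can return. -/
theorem possible_of_isRead (h : Graph.Step σ b σ') (hb : b.act.isRead) (γ : Tid → RegFile) :
    Possible b.act.loc b.act.val b.tid ⟨σ, γ⟩ := by
  cases h with
  | read w _ _ hw hloc hval => exact ⟨w, hw, hloc, hval⟩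
  | write w _ hb' =>
    revert hb hb'
    cases b.act <;> simp [Action.isRead, Action.isWrite]

theorem notPossible (h : Graph.Step σ b σ') {γ γ' : Tid → RegFile} {z : Loc} {v : Val} {t : Tid}
    (hn : NotPossible z v t ⟨σ, γ⟩) (hb : ¬ (b.act.isWrite ∧ b.act.loc = z ∧ b.act.val = v)) :
    NotPossible z v t ⟨σ', γ'⟩ := by
  rintro ⟨w, hw, hloc, hval⟩
  obtain hw | ⟨hbw, rfl⟩ := h.OW_subset hw
  · exact hn ⟨w, hw, hloc, hval⟩
  · exact hb ⟨hbw, hloc, hval⟩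

/-- No write to `z` is added, so nothing new is observable at `z`. The unique observable write
remains last in modification order, hence observable. -/
theorem definite (h : Graph.Step σ b σ') {γ γ' : Tid → RegFile} {z : Loc} {v : Val} {t : Tid}
    (hd : Definite z v t ⟨σ, γ⟩) (hb : ¬ (b.act.isWrite ∧ b.act.loc = z)) :
    Definite z v t ⟨σ', γ'⟩ := by
  obtain ⟨w, hw, hlast, hval⟩ := hd
  have hwm : w ∈ σ.OW t ∧ w.act.loc = z := by
    have : w ∈ {w' ∈ σ.OW t | w'.act.loc = z} := by rw [hw]; rfl
    exact this
  have hlast' : ∀ w', ¬ σ'.mo w w' := by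
    have hne : w ≠ b := fun e => h.notMem (e ▸ hwm.1.1)
    cases h with
    | read => exact hlast
    | write u _ hbw _ hloc =>
      -- A new successor of `w` arises only if `b` is inserted after `w`, which forces the location
      -- `z`, or after a successor of `w`, or if `w` is `b` itself, contrary to freshness.
      rintro w' (h | ⟨rfl | h, -⟩ | ⟨h, -⟩)
      · exact hlast _ h
      · exact hb ⟨hbw, hloc.symm.trans hwm.2⟩
      · exact hlast _ h
      · exact hne h
  refine ⟨w, Set.ext fun w' => ⟨?_, ?_⟩, hlast', hval⟩
  · rintro ⟨hw', hloc⟩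
    obtain hw' | ⟨hbw, rfl⟩ := h.OW_subset hw'
    · rw [← hw]
      exact ⟨hw', hloc⟩
    · exact absurd ⟨hbw, hloc⟩ hb
  · rintro rfl
    exact ⟨⟨h.D_eq ▸ Or.inr hwm.1.1, hwm.1.2.1, fun _ _ => hlast' _⟩, hwm.2⟩

end Graph.Step

theorem Definite.eq_of_possible {z : Loc} {v v' : Val} {t : Tid} {c : Config}
    (hd : Definite z v t c) (hp : Possible z v' t c) : v' = v := by
  obtain ⟨w, hw, -, rfl⟩ := hd
  obtain ⟨w', hw', hloc, rfl⟩ := hp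
  have : w' ∈ ({w} : Set TAct) := hw ▸ ⟨hw', hloc⟩
  rw [Set.mem_singleton_iff.1 this]

namespace RNG

/-! ### Candidate futures -/

/-- The write has the read below it; here the dependency keeps the write from being executed early.
-/
theorem available_branch {V : Set Val} {t : Tid} {v : Val} {a : Action}
    (h : Available (prog.denote V) a (branch t v)) : t ∈ prog.tids ∧ a = readAct t v := by
  obtain ⟨g, ⟨ht, rfl | ⟨w, hw, rfl⟩⟩, rfl, hmin⟩ := h
  · exact ⟨ht, rfl⟩
  · exact absurd ⟨ht, rfl, w, hw, rfl⟩ (hmin _ (root_mem_branch ht v) (by simp))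

theorem available_readAct_branch {V : Set Val} {t : Tid} (ht : t ∈ prog.tids) (v : Val) :
    Available (prog.denote V) (readAct t v) (branch t v) := by
  refine ⟨_, root_mem_branch ht v, rfl, ?_⟩
  rintro g' - - ⟨-, -, w, -, h⟩
  simp at h

theorem branch_after {V : Set Val} {t : Tid} (ht : t ∈ prog.tids) (v : Val) :
    (branch t v).after (prog.denote V) (readAct t v) = rest t v := by
  refine Future.ext (Set.ext fun e => ?_) ?_
  · constructor
    · rintro ⟨⟨-, rfl | h⟩, hne⟩
      · exact absurd rfl hne
      · exact h
    · rintro ⟨w, hw, rfl⟩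
      exact ⟨⟨ht, Or.inr ⟨w, hw, rfl⟩⟩, fun h => readAct_ne_of_mem_writeAct hw h.symm⟩
  · funext a b
    refine propext ⟨?_, fun h => h.elim⟩
    rintro ⟨⟨-, hne⟩, -, -, rfl, -⟩
    exact hne rfl

/-- The read action determines its value, so executing it discards every other branch. -/
theorem candidates_futures {V : Set Val} (hV : {0, 1, 100} ⊆ V) {t : Tid} (ht : t ∈ prog.tids)
    {v : Val} (hv : v ∈ V) :
    candidates (prog.denote V) (readAct t v) (futures V t) = {rest t v} := by
  rw [futures_eq hV]
  ext f
  constructor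
  · rintro ⟨_, ⟨v', -, rfl⟩, hav, rfl⟩
    obtain rfl := readAct_injective t (available_branch hav).2
    exact branch_after ht v
  · rintro rfl
    exact ⟨_, ⟨v, hv, rfl⟩, available_readAct_branch ht v, (branch_after ht v).symm⟩

theorem exists_of_candidates_futures {V : Set Val} (hV : {0, 1, 100} ⊆ V) {t : Tid} {a : Action}
    (h : (candidates (prog.denote V) a (futures V t)).Nonempty) :
    t ∈ prog.tids ∧ ∃ v ∈ V, a = readAct t v := by
  obtain ⟨_, f, hf, hav, -⟩ := h
  rw [futures_eq hV] at hf
  obtain ⟨v, hv, rfl⟩ := hf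
  exact ⟨(available_branch hav).1, v, hv, (available_branch hav).2⟩

theorem not_candidates_done {μ : CES} {a : Action} :
    ¬ (candidates μ a {Future.done}).Nonempty := by
  rintro ⟨_, _, rfl, ⟨g, hg, -⟩, -⟩
  exact hg

theorem candidates_rest {V : Set Val} {t : Tid} {v : Val} {a : Action}
    (h : (candidates (prog.denote V) a {rest t v}).Nonempty) :
    a ∈ writeAct t v ∧ candidates (prog.denote V) a {rest t v} = {Future.done} := by
  obtain ⟨_, _, rfl, hav, -⟩ := h
  have ha : a ∈ writeAct t v := by
    obtain ⟨g, ⟨w, hw, rfl⟩, rfl, -⟩ := hav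
    exact hw
  have hafter : (rest t v).after (prog.denote V) a = Future.done := by
    refine Future.ext (Set.ext fun e => ⟨?_, fun h => h.elim⟩) ?_
    · rintro ⟨⟨w, hw, rfl⟩, hne⟩
      exact hne (Option.mem_unique hw ha)
    · funext p q
      exact propext ⟨fun h => h.2.2, fun h => h.elim⟩
  refine ⟨ha, Set.ext fun f => ⟨?_, ?_⟩⟩
  · rintro ⟨_, rfl, -, rfl⟩
    exact hafter
  · rintro rfl
    exact ⟨_, rfl, hav, hafter.symm⟩

theorem rest_eq_done {t : Tid} {v : Val} (h : writeAct t v = none) : rest t v = Future.done := by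
  refine Future.ext (Set.ext fun e => ?_) rfl
  simp [rest, h, Future.done]

theorem rest_ne_done {t : Tid} {v : Val} {w : Action} (h : writeAct t v = some w) :
    ({rest t v} : Set Future) ≠ {Future.done} := by
  intro heq
  have hK : (rest t v).K = ∅ := by rw [Set.singleton_injective heq]; rfl
  have : ((t, ⟨[readAct t v], w⟩) : Event) ∈ (rest t v).K := ⟨w, h, rfl⟩
  rw [hK] at this
  exact this

/-- Since `outlinePred` demands every annotation whose index contains the current set of futures,
different stages of a thread must be told apart; the initial futures still contain a read. -/
theorem futures_ne_rest {V : Set Val} (hV : {0, 1, 100} ⊆ V) {t : Tid} (ht : t ∈ prog.tids)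
    (v : Val) : futures V t ≠ {rest t v} := by
  intro heq
  have h : branch t 0 ∈ futures V t := by
    rw [futures_eq hV]
    exact ⟨0, hV (by simp), rfl⟩
  rw [heq] at h
  have hm := root_mem_branch ht 0
  rw [Set.mem_singleton_iff.1 h] at hm
  obtain ⟨w, -, h⟩ := hm
  simp at h

theorem futures_ne_done {V : Set Val} (hV : {0, 1, 100} ⊆ V) {t : Tid} (ht : t ∈ prog.tids) :
    futures V t ≠ {Future.done} := by
  intro heq
  have h : branch t 0 ∈ futures V t := by
    rw [futures_eq hV]
    exact ⟨0, hV (by simp), rfl⟩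
  rw [heq] at h
  have hm := root_mem_branch ht 0
  rw [Set.mem_singleton_iff.1 h] at hm
  exact hm

/-! ### The assertions of the outline -/

theorem one_mem : 1 ∈ prog.tids := by simp [prog]
theorem two_mem : 2 ∈ prog.tids := by simp [prog]
theorem three_mem : 3 ∈ prog.tids := by simp [prog]

/-- The three stages have different sets of futures, so exactly one annotation applies at each. -/
theorem outline_one {V : Set Val} (hV : {0, 1, 100} ⊆ V) {G : Set Future} {c : Config} :
    outline V 1 G c ↔ (G = futures V 1 ∧ pre1 c) ∨
      (∃ v ∈ V, G = {rest 1 v} ∧ Definite y 0 3 c ∧ c.γ 1 r1 = 0) ∨ G = {Future.done} := by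
  have hr : ∀ v ∈ V, futuresAfterRead V 1 1 x v = {rest 1 v} := fun v hv =>
    candidates_futures hV one_mem hv
  simp only [outline, outlinePred, outline1, List.mem_cons, List.not_mem_nil, or_false,
    forall_eq_or_imp, exists_eq_or_imp, exists_eq_left, forall_eq, Set.mem_singleton_iff,
    Set.mem_ofPred_eq, implies_true, and_true]
  constructor
  · rintro ⟨h | ⟨v, hv, h⟩ | h, h1, h2⟩
    · exact Or.inl ⟨h, h1 h⟩
    · exact Or.inr (Or.inl ⟨v, hv, h.trans (hr v hv), h2 ⟨v, hv, h⟩⟩)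
    · exact Or.inr (Or.inr h)
  · rintro (⟨rfl, h⟩ | ⟨v, hv, rfl, h⟩ | rfl)
    · refine ⟨Or.inl rfl, fun _ => h, ?_⟩
      rintro ⟨v, hv, h⟩
      exact absurd (h.trans (hr v hv)) (futures_ne_rest hV one_mem v)
    · exact ⟨Or.inr (Or.inl ⟨v, hv, (hr v hv).symm⟩),
        fun h => absurd h.symm (futures_ne_rest hV one_mem v), fun _ => h⟩
    · refine ⟨Or.inr (Or.inr rfl), fun h => absurd h.symm (futures_ne_done hV one_mem), ?_⟩
      rintro ⟨v, hv, h⟩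
      exact absurd (h.trans (hr v hv)).symm (rest_ne_done rfl)

theorem outline_two {V : Set Val} (hV : {0, 1, 100} ⊆ V) {G : Set Future} {c : Config} :
    outline V 2 G c ↔ (G = futures V 2 ∧ pre2 c) ∨
      (∃ v ∈ V, G = {rest 2 v} ∧ (∀ t ∈ ({1, 2, 3} : Set Tid), Definite x 0 t c) ∧
        c.γ 2 r2 ∈ ({0, 1} : Set Val)) ∨ G = {Future.done} := by
  have hr : ∀ v ∈ V, futuresAfterRead V 2 3 y v = {rest 2 v} := fun v hv =>
    candidates_futures hV two_mem hv
  simp only [outline, outlinePred, outline2, List.mem_cons, List.not_mem_nil, or_false,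
    forall_eq_or_imp, exists_eq_or_imp, exists_eq_left, forall_eq, Set.mem_singleton_iff,
    Set.mem_ofPred_eq, implies_true, and_true]
  constructor
  · rintro ⟨h | ⟨v, hv, h⟩ | h, h1, h2⟩
    · exact Or.inl ⟨h, h1 h⟩
    · exact Or.inr (Or.inl ⟨v, hv, h.trans (hr v hv), h2 ⟨v, hv, h⟩⟩)
    · exact Or.inr (Or.inr h)
  · rintro (⟨rfl, h⟩ | ⟨v, hv, rfl, h⟩ | rfl)
    · refine ⟨Or.inl rfl, fun _ => h, ?_⟩
      rintro ⟨v, hv, h⟩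
      exact absurd (h.trans (hr v hv)) (futures_ne_rest hV two_mem v)
    · exact ⟨Or.inr (Or.inl ⟨v, hv, (hr v hv).symm⟩),
        fun h => absurd h.symm (futures_ne_rest hV two_mem v), fun _ => h⟩
    · refine ⟨Or.inr (Or.inr rfl), fun h => absurd h.symm (futures_ne_done hV two_mem), ?_⟩
      rintro ⟨v, hv, h⟩
      exact absurd (h.trans (hr v hv)).symm (rest_ne_done rfl)

/-- Once thread 3 has read a value other than `100` it is done; having read `100` is excluded. -/
theorem outline_three {V : Set Val} (hV : {0, 1, 100} ⊆ V) {G : Set Future} {c : Config} :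
    outline V 3 G c ↔ (G = futures V 3 ∧ pre3 c) ∨
      (G = {Future.done} ∧ c.γ 3 r3 ∈ ({0, 1} : Set Val) ∧ Post c) := by
  have hr : ∀ v ∈ V, futuresAfterRead V 3 5 x v = {rest 3 v} := fun v hv =>
    candidates_futures hV three_mem hv
  have h100 : ({rest 3 100} : Set Future) ≠ {Future.done} :=
    rest_ne_done (w := .wr false 6 x 99) (by simp [writeAct])
  have hdone : ∀ v : Val, v ≠ 100 → rest 3 v = Future.done := fun v hv =>
    rest_eq_done (by simp [writeAct, hv])
  have hm0 : (0 : Val) ∈ V := hV (by simp)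
  have hm100 : (100 : Val) ∈ V := hV (by simp)
  have hdone0 : ({Future.done} : Set Future) = futuresAfterRead V 3 5 x 0 := by
    rw [hr 0 hm0, hdone 0 (by norm_num)]
  simp only [outline, outlinePred, outline3, List.mem_cons, List.not_mem_nil, or_false,
    forall_eq_or_imp, exists_eq_or_imp, exists_eq_left, forall_eq, Set.mem_singleton_iff,
    Set.mem_ofPred_eq]
  constructor
  · rintro ⟨h, h1, h2, h3, h4⟩
    obtain h | h : G = futures V 3 ∨ G = {Future.done} := by
      obtain h | ⟨v, hv, h⟩ | h | h := h
      · exact Or.inl h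
      · by_cases h' : v = 100
        · subst h'
          exact (h3 h).elim
        · rw [h, hr v hv, hdone v h']
          exact Or.inr rfl
      · exact (h3 h).elim
      · exact Or.inr h
    · exact Or.inl ⟨h, h1 h⟩
    · exact Or.inr ⟨h, h2 ⟨0, hm0, h.trans hdone0⟩⟩
  · rintro (⟨rfl, h⟩ | ⟨rfl, h⟩)
    · refine ⟨Or.inl rfl, fun _ => h, ?_, fun h => ?_,
        fun h => absurd h (futures_ne_done hV three_mem)⟩
      · rintro ⟨v, hv, h⟩
        exact absurd (h.trans (hr v hv)) (futures_ne_rest hV three_mem v)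
      · exact futures_ne_rest hV three_mem 100 (h.trans (hr 100 hm100))
    · exact ⟨Or.inr (Or.inr (Or.inr rfl)),
        fun h => absurd h.symm (futures_ne_done hV three_mem), fun _ => h,
        fun h => h100 (h.trans (hr 100 hm100)).symm, fun _ => h.2⟩

end RNG

end MRD

namespace MRD

theorem LocalStep.label_eq {t : Tid} {γ γ' : Tid → RegFile} {s : ACom} {a : Action}
    (h : LocalStep t γ s a γ') : a.label = s.label := by
  cases h <;> rfl

namespace RNG

/-! ### Local and global correctness -/

/-- The thread whose code contains the given label. -/
def owner : Label → Tid
  | 1 | 2 => 1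
  | 3 | 4 => 2
  | 5 | 6 => 3
  | _ => 0

theorem owner_of_mem_branch {t : Tid} {v : Val} {e : Event} (h : e ∈ (branch t v).K) :
    owner e.2.act.label = t := by
  obtain ⟨ht, h⟩ := h
  obtain rfl | rfl | rfl := mem_tids.1 ht
  · obtain rfl | ⟨w, hw, rfl⟩ := h
    · rfl
    · obtain rfl : Action.wr false 2 y (v + 1) = w := by simpa [writeAct] using hw
      rfl
  · obtain rfl | ⟨w, hw, rfl⟩ := h
    · rfl
    · obtain rfl : Action.wr false 4 x v = w := by simpa [writeAct] using hw
      rfl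
  · obtain rfl | ⟨w, hw, rfl⟩ := h
    · rfl
    · obtain ⟨-, rfl⟩ : v = 100 ∧ Action.wr false 6 x 99 = w := by simpa [writeAct] using hw
      rfl

theorem atomicSet_one {s : ACom} (hs : s ∈ prog.atomicSet 1) :
    s = .load false 1 r1 x ∨ s = .store false 2 y (fun ρ => ρ r1 + 1) := hs

theorem atomicSet_two {s : ACom} (hs : s ∈ prog.atomicSet 2) :
    s = .load false 3 r2 y ∨ s = .store false 4 x (fun ρ => ρ r2) := hs

theorem atomicSet_three {s : ACom} (hs : s ∈ prog.atomicSet 3) :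
    s = .load false 5 r3 x ∨ s = line6 := by
  simpa [prog, Program.atomicSet, thread3, Com.atomicSet, or_comm] using hs

theorem mem_tids_of_atomicSet {t : Tid} {s : ACom} (hs : s ∈ prog.atomicSet t) :
    t ∈ prog.tids := by
  by_contra ht
  have : prog.com t = .skip := by
    rw [mem_tids] at ht
    simp only [prog]
    split <;> simp_all
  simp [Program.atomicSet, this, Com.atomicSet] at hs

theorem owner_of_mem_atomicSet {t : Tid} {s : ACom} (hs : s ∈ prog.atomicSet t) :
    owner s.label = t := by
  obtain rfl | rfl | rfl := mem_tids.1 (mem_tids_of_atomicSet hs)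
  · obtain rfl | rfl := atomicSet_one hs <;> rfl
  · obtain rfl | rfl := atomicSet_two hs <;> rfl
  · obtain rfl | rfl := atomicSet_three hs <;> rfl

section Steps

variable {V : Set Val} {G : Set Future} {σ σ' : Graph} {γ γ' : Tid → RegFile} {s : ACom}
  {a : Action} {g : ℕ}

/-- The steps of thread 1 from a state satisfying its assertions. -/
theorem step_one (hV : {0, 1, 100} ⊆ V) (hs : s ∈ prog.atomicSet 1)
    (hI : outline V 1 G ⟨σ, γ⟩) (ha : (candidates (prog.denote V) a G).Nonempty)
    (hl : LocalStep 1 γ s a γ') (hm : Graph.Step σ ⟨g, a, 1⟩ σ') :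
    (a = .rd false 1 x 0 ∧ pre1 ⟨σ, γ⟩ ∧ candidates (prog.denote V) a G = {rest 1 0} ∧
      γ' = Function.update γ 1 (Function.update (γ 1) r1 0)) ∨
    (a = .wr false 2 y 1 ∧ candidates (prog.denote V) a G = {Future.done} ∧ γ' = γ) := by
  obtain ⟨rfl, hp⟩ | ⟨v, -, rfl, -, hr⟩ | rfl := (outline_one hV).1 hI
  · obtain ⟨-, v, hv, rfl⟩ := exists_of_candidates_futures hV ha
    have hv0 : v = 0 := by
      by_contra hne
      exact hp.2.2.2 v hne (hm.possible_of_isRead trivial γ)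
    subst hv0
    obtain rfl | rfl := atomicSet_one hs
    · cases hl
      exact Or.inl ⟨rfl, hp, candidates_futures hV one_mem hv, rfl⟩
    · nomatch hl
  · obtain ⟨hw, hc⟩ := candidates_rest ha
    obtain rfl : Action.wr false 2 y (v + 1) = a := by simpa [writeAct] using hw
    obtain rfl | rfl := atomicSet_one hs
    · nomatch hl
    -- The event gives the written value as `v + 1`, the command as `γ 1 r1 + 1`. Generalising the
    -- action keeps the latter, which the assertion `r1 = 0` evaluates to `1`.
    · generalize Action.wr false 2 y (v + 1) = b at *
      cases hl
      refine Or.inr ⟨?_, hc, rfl⟩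
      simp only at hr
      simp [hr]
  · exact absurd ha not_candidates_done

/-- The steps of thread 2 from a state satisfying its assertions. -/
theorem step_two (hV : {0, 1, 100} ⊆ V) (hs : s ∈ prog.atomicSet 2)
    (hI : outline V 2 G ⟨σ, γ⟩) (ha : (candidates (prog.denote V) a G).Nonempty)
    (hl : LocalStep 2 γ s a γ') (hm : Graph.Step σ ⟨g, a, 2⟩ σ') :
    (∃ v ∈ V, v ∈ ({0, 1} : Set Val) ∧ a = .rd false 3 y v ∧ pre2 ⟨σ, γ⟩ ∧
      Possible y v 2 ⟨σ, γ⟩ ∧ candidates (prog.denote V) a G = {rest 2 v} ∧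
      γ' = Function.update γ 2 (Function.update (γ 2) r2 v)) ∨
    (a = .wr false 4 x (γ 2 r2) ∧ γ 2 r2 ∈ ({0, 1} : Set Val) ∧
      candidates (prog.denote V) a G = {Future.done} ∧ γ' = γ) := by
  obtain ⟨rfl, hp⟩ | ⟨v, -, rfl, -, hr⟩ | rfl := (outline_two hV).1 hI
  · obtain ⟨-, v, hv, rfl⟩ := exists_of_candidates_futures hV ha
    have hpos : Possible y v 2 ⟨σ, γ⟩ := hm.possible_of_isRead trivial γ
    have hv01 : v ∈ ({0, 1} : Set Val) := by
      by_contra hne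
      exact hp.2 v hne hpos
    obtain rfl | rfl := atomicSet_two hs
    · cases hl
      exact Or.inl ⟨v, hv, hv01, rfl, hp, hpos, candidates_futures hV two_mem hv, rfl⟩
    · nomatch hl
  · obtain ⟨hw, hc⟩ := candidates_rest ha
    obtain rfl : Action.wr false 4 x v = a := by simpa [writeAct] using hw
    obtain rfl | rfl := atomicSet_two hs
    · nomatch hl
    · generalize Action.wr false 4 x v = b at *
      cases hl
      exact Or.inr ⟨rfl, hr, hc, rfl⟩
  · exact absurd ha not_candidates_done

/-- The steps of thread 3 from a state satisfying its assertions. -/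
theorem step_three (hV : {0, 1, 100} ⊆ V) (hs : s ∈ prog.atomicSet 3)
    (hI : outline V 3 G ⟨σ, γ⟩) (ha : (candidates (prog.denote V) a G).Nonempty)
    (hl : LocalStep 3 γ s a γ') (hm : Graph.Step σ ⟨g, a, 3⟩ σ') :
    ∃ v ∈ ({0, 1} : Set Val), a = .rd false 5 x v ∧ pre3 ⟨σ, γ⟩ ∧ s ≠ line6 ∧
      candidates (prog.denote V) a G = {Future.done} ∧
      γ' = Function.update γ 3 (Function.update (γ 3) r3 v) := by
  obtain ⟨rfl, hp⟩ | ⟨rfl, -⟩ := (outline_three hV).1 hI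
  · obtain ⟨-, v, hv, rfl⟩ := exists_of_candidates_futures hV ha
    have hv01 : v ∈ ({0, 1} : Set Val) := by
      by_contra hne
      exact hp.1 v hne (hm.possible_of_isRead trivial γ)
    have hne : v ≠ 100 := by
      rintro rfl
      simp at hv01
    obtain rfl | rfl := atomicSet_three hs
    · cases hl
      refine ⟨v, hv01, rfl, hp, by simp [line6], ?_, rfl⟩
      rw [candidates_futures hV three_mem hv, rest_eq_done (by simp [writeAct, hne])]
    · nomatch hl
  · exact absurd ha not_candidates_done

/-- A step of a thread leads from its assertions to its assertions. -/
theorem outline_step_self (hV : {0, 1, 100} ⊆ V) {t : Tid} (hs : s ∈ prog.atomicSet t)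
    (hI : outline V t G ⟨σ, γ⟩) (ha : (candidates (prog.denote V) a G).Nonempty)
    (hl : LocalStep t γ s a γ') (hm : Graph.Step σ ⟨g, a, t⟩ σ') :
    outline V t (candidates (prog.denote V) a G) ⟨σ', γ'⟩ := by
  obtain rfl | rfl | rfl := mem_tids.1 (mem_tids_of_atomicSet hs)
  · obtain ⟨rfl, hp, hc, rfl⟩ | ⟨rfl, hc, rfl⟩ := step_one hV hs hI ha hl hm
    · exact (outline_one hV).2 (Or.inr (Or.inl ⟨0, hV (by simp), hc,
        hm.definite hp.2.1 (fun h => h.1), by simp⟩))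
    · exact (outline_one hV).2 (Or.inr (Or.inr hc))
  · obtain ⟨v, hv, hv01, rfl, hp, -, hc, rfl⟩ | ⟨rfl, -, hc, rfl⟩ := step_two hV hs hI ha hl hm
    · exact (outline_two hV).2 (Or.inr (Or.inl ⟨v, hv, hc,
        fun t ht => hm.definite (hp.1 t ht) (fun h => h.1), by simpa using hv01⟩))
    · exact (outline_two hV).2 (Or.inr (Or.inr hc))
  · obtain ⟨v, hv01, rfl, hp, -, hc, rfl⟩ := step_three hV hs hI ha hl hm
    exact (outline_three hV).2 (Or.inr ⟨hc, by simpa using hv01,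
      fun t ht => hm.notPossible (hp.2 t ht) (fun h => h.1)⟩)

/-- A step of a thread from its assertions preserves the assertions of the other threads. -/
theorem outline_step_other (hV : {0, 1, 100} ⊆ V) {t t' : Tid} (ht' : t' ∈ prog.tids)
    (hne : t' ≠ t) {F : Set Future} (hF : outline V t' F ⟨σ, γ⟩) (hs : s ∈ prog.atomicSet t)
    (hI : outline V t G ⟨σ, γ⟩) (ha : (candidates (prog.denote V) a G).Nonempty)
    (hl : LocalStep t γ s a γ') (hm : Graph.Step σ ⟨g, a, t⟩ σ') :
    outline V t' F ⟨σ', γ'⟩ := by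
  obtain rfl | rfl | rfl := mem_tids.1 ht'
  · have hreg : γ' 1 = γ 1 := by
      cases hl with
      | store => rfl
      | load => simp [Function.update_of_ne hne]
    -- The interference with thread 1: thread 3 only reads, and thread 2 writes only `r2`, only to
    -- `x`. A read by thread 2 leaves `r2 = 0` because `pre1` includes `[y = 0]_2`.
    have hwy : ¬ (a.isWrite ∧ a.loc = y) ∧ (a.isWrite → a.loc = x → a.val = γ 2 r2) ∧
        (pre1 ⟨σ, γ⟩ → γ' 2 r2 = 0) := by
      obtain rfl | rfl | rfl := mem_tids.1 (mem_tids_of_atomicSet hs)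
      · exact absurd rfl hne
      · obtain ⟨v, -, -, rfl, -, hpos, -, rfl⟩ | ⟨rfl, -, -, rfl⟩ := step_two hV hs hI ha hl hm
        · exact ⟨fun h => h.1, fun h => h.elim, fun hp => by simp [hp.1.eq_of_possible hpos]⟩
        · exact ⟨by simp [Action.loc, x, y], fun _ _ => rfl, fun hp => hp.2.2.1⟩
      · obtain ⟨v, -, rfl, -, -, -, rfl⟩ := step_three hV hs hI ha hl hm
        exact ⟨fun h => h.1, fun h => h.elim, fun hp => by simpa using hp.2.2.1⟩
    obtain ⟨rfl, hp⟩ | ⟨v, hv, rfl, hd, hr⟩ | rfl := (outline_one hV).1 hF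
    · refine (outline_one hV).2 (Or.inl ⟨rfl, hm.definite hp.1 hwy.1, hm.definite hp.2.1 hwy.1,
        hwy.2.2 hp, fun i hi => hm.notPossible (hp.2.2.2 i hi) ?_⟩)
      rintro ⟨hw, hloc, rfl⟩
      exact hi ((hwy.2.1 hw hloc).trans hp.2.2.1)
    · exact (outline_one hV).2 (Or.inr (Or.inl ⟨v, hv, rfl, hm.definite hd hwy.1,
        (congrFun hreg r1).trans hr⟩))
    · exact (outline_one hV).2 (Or.inr (Or.inr rfl))
  · have hreg : γ' 2 = γ 2 := by
      cases hl with
      | store => rfl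
      | load => simp [Function.update_of_ne hne]
    -- The interference with thread 2: the only possible write is that of `1` to `y` by thread 1.
    have hwx : ¬ (a.isWrite ∧ a.loc = x) ∧ (a.isWrite → a.val = 1) := by
      obtain rfl | rfl | rfl := mem_tids.1 (mem_tids_of_atomicSet hs)
      · obtain ⟨rfl, -⟩ | ⟨rfl, -⟩ := step_one hV hs hI ha hl hm
        · exact ⟨fun h => h.1, fun h => h.elim⟩
        · exact ⟨by simp [Action.loc, x, y], fun _ => rfl⟩
      · exact absurd rfl hne
      · obtain ⟨v, -, rfl, -⟩ := step_three hV hs hI ha hl hm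
        exact ⟨fun h => h.1, fun h => h.elim⟩
    obtain ⟨rfl, hp⟩ | ⟨v, hv, rfl, hd, hr⟩ | rfl := (outline_two hV).1 hF
    · refine (outline_two hV).2 (Or.inl ⟨rfl, fun t ht => hm.definite (hp.1 t ht) hwx.1,
        fun i hi => hm.notPossible (hp.2 i hi) ?_⟩)
      rintro ⟨hw, -, rfl⟩
      exact hi (Or.inr (hwx.2 hw))
    · refine (outline_two hV).2 (Or.inr (Or.inl ⟨v, hv, rfl,
        fun t ht => hm.definite (hd t ht) hwx.1, ?_⟩))
      rwa [show (Config.mk σ' γ').γ 2 = γ 2 from hreg]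
    · exact (outline_two hV).2 (Or.inr (Or.inr rfl))
  · have hreg : γ' 3 = γ 3 := by
      cases hl with
      | store => rfl
      | load => simp [Function.update_of_ne hne]
    -- The interference with thread 3: thread 2 writes `r2`, which is `0` or `1`, so neither `99`
    -- nor `100` reaches `x`.
    have hwx : a.isWrite → a.loc = x → a.val ∈ ({0, 1} : Set Val) := by
      obtain rfl | rfl | rfl := mem_tids.1 (mem_tids_of_atomicSet hs)
      · obtain ⟨rfl, -⟩ | ⟨rfl, -⟩ := step_one hV hs hI ha hl hm
        · exact fun h => h.elim
        · exact fun _ _ => Or.inr rfl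
      · obtain ⟨v, -, -, rfl, -⟩ | ⟨rfl, hr, -⟩ := step_two hV hs hI ha hl hm
        · exact fun h => h.elim
        · exact fun _ _ => hr
      · exact absurd rfl hne
    have hpost : Post ⟨σ, γ⟩ → Post ⟨σ', γ'⟩ := by
      intro hp t ht
      refine hm.notPossible (hp t ht) ?_
      rintro ⟨hw, hloc, hval⟩
      have := hwx hw hloc
      rw [show a.val = 99 from hval] at this
      simp at this
    obtain ⟨rfl, hp⟩ | ⟨rfl, hr, hp⟩ := (outline_three hV).1 hF
    · refine (outline_three hV).2 (Or.inl ⟨rfl, fun i hi => hm.notPossible (hp.1 i hi) ?_,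
        hpost hp.2⟩)
      rintro ⟨hw, hloc, rfl⟩
      exact hi (hwx hw hloc)
    · refine (outline_three hV).2 (Or.inr ⟨rfl, ?_, hpost hp⟩)
      rwa [show (Config.mk σ' γ').γ 3 = γ 3 from hreg]

end Steps

/-! ### The initial state and validity of the outline -/

theorem EW_initGraph {t : Tid} (ht : t ∈ ({1, 2, 3} : Set Tid)) : initGraph.EW t = ∅ := by
  refine Set.eq_empty_of_forall_notMem ?_
  rintro w ⟨-, -, b, hb, rfl, -⟩
  obtain rfl | rfl := hb <;> simp at ht

theorem mem_OW_initGraph {t : Tid} {w : TAct} (ht : t ∈ ({1, 2, 3} : Set Tid)) :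
    w ∈ initGraph.OW t ↔ w ∈ initGraph.D := by
  simp only [Graph.OW, EW_initGraph ht]
  constructor
  · exact fun h => h.1
  · intro h
    refine ⟨h, ?_, fun _ h => h.elim⟩
    obtain rfl | rfl := h <;> trivial

theorem definite_initGraph {γ : Tid → RegFile} {z : Loc} {t : Tid} (hz : z = x ∨ z = y)
    (ht : t ∈ ({1, 2, 3} : Set Tid)) : Definite z 0 t ⟨initGraph, γ⟩ := by
  -- The tags `0` and `1` of the initial writes coincide with the locations `x` and `y`, so `z`
  -- serves as both.
  refine ⟨⟨z, .wr false 0 z 0, 0⟩, Set.ext fun w => ?_, fun _ h => h, rfl⟩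
  simp only [Set.mem_ofPred_eq, mem_OW_initGraph ht, Set.mem_singleton_iff]
  constructor
  · rintro ⟨rfl | rfl, rfl⟩ <;> rfl
  · rintro rfl
    obtain rfl | rfl := hz
    · exact ⟨Or.inl rfl, rfl⟩
    · exact ⟨Or.inr rfl, rfl⟩

theorem pre_of_init {c : Config} (h : Init c) : Pre c := by
  obtain ⟨σ, γ⟩ := c
  obtain ⟨h, -, hr2, -⟩ := h
  obtain rfl : σ = initGraph := h
  have hx : ∀ t ∈ ({1, 2, 3} : Set Tid), Definite x 0 t ⟨initGraph, γ⟩ := fun t ht =>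
    definite_initGraph (Or.inl rfl) ht
  have hy : ∀ t ∈ ({1, 2, 3} : Set Tid), Definite y 0 t ⟨initGraph, γ⟩ := fun t ht =>
    definite_initGraph (Or.inr rfl) ht
  refine ⟨⟨hy 2 (by simp), hy 3 (by simp), hr2, fun i hi hp => ?_⟩,
    ⟨hx, fun i hi hp => ?_⟩, fun i hi hp => ?_, fun t ht hp => ?_⟩
  · exact hi ((hx 1 (by simp)).eq_of_possible hp)
  · exact hi (Or.inl ((hy 2 (by simp)).eq_of_possible hp))
  · exact hi (Or.inl ((hx 3 (by simp)).eq_of_possible hp))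
  · exact absurd ((hx t ht).eq_of_possible hp) (by norm_num)

theorem outline_of_pre {V : Set Val} (hV : {0, 1, 100} ⊆ V) {c : Config} (h : Pre c) {t : Tid}
    (ht : t ∈ prog.tids) : outline V t (futures V t) c := by
  obtain rfl | rfl | rfl := mem_tids.1 ht
  · exact (outline_one hV).2 (Or.inl ⟨rfl, h.1⟩)
  · exact (outline_two hV).2 (Or.inl ⟨rfl, h.2.1⟩)
  · exact (outline_three hV).2 (Or.inl ⟨rfl, h.2.2⟩)

theorem post_of_outline {V : Set Val} (hV : {0, 1, 100} ⊆ V) {G : Set Future} {c : Config}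
    (h : outline V 3 G c) : Post c := by
  obtain ⟨-, h⟩ | ⟨-, h⟩ := (outline_three hV).1 h
  · exact h.2
  · exact h.2

/-- A command that is executed along futures of thread `t` belongs to thread `t`. -/
theorem eq_of_candidates_subFuture {V : Set Val} (hV : {0, 1, 100} ⊆ V) {t t' : Tid}
    {G : Set Future} (hG : SubFuture G (futures V t)) {s : ACom} (hs : s ∈ prog.atomicSet t')
    {a : Action} {γ γ' : Tid → RegFile} (hl : LocalStep t' γ s a γ')
    (ha : (candidates (prog.denote V) a G).Nonempty) : t' = t := by
  obtain ⟨_, f, hf, ⟨e, he, hlab, -⟩, -⟩ := ha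
  obtain ⟨f', hf', hsub, -⟩ := hG f hf
  rw [futures_eq hV] at hf'
  obtain ⟨v, -, rfl⟩ := hf'
  rw [← owner_of_mem_branch (hsub he), ← owner_of_mem_atomicSet hs, ← hl.label_eq, ← hlab]
  rfl

/-- A step triple does not fix the acting thread. The available event must come from the given
sub-future, and its label then forces the thread, leaving `outline_step_self` and
`outline_step_other`. -/
theorem outlineValid {V : Set Val} (hV : {0, 1, 100} ⊆ V) :
    OutlineValid V Init Pre prog (outline V) Post where
  init _ := pre_of_init
  start _ _ h _ ht := outline_of_pre hV h ht
  finish _ _ h := post_of_outline hV (h 3 three_mem)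
  localCorrect := by
    rintro t - G Q hG hQ - c Q' c' G' - hI ⟨t', s, hstep⟩
    cases hstep with
    | mk _ σ σ' γ γ' _ g a hs ha hl hm =>
      obtain rfl := eq_of_candidates_subFuture hV hG (hQ _ hs) hl ha
      exact outline_step_self hV (hQ _ hs) hI ha hl hm
  globalCorrect := by
    rintro t₁ ht₁ t₂ - hne F₁ F₂ Q - hF₂ hQ - c Q' c' G' - ⟨hI₁, hI₂⟩ ⟨t', s, hstep⟩
    cases hstep with
    | mk _ σ σ' γ γ' _ g a hs ha hl hm =>
      obtain rfl := eq_of_candidates_subFuture hV hF₂ (hQ _ hs) hl ha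
      exact outline_step_other hV ht₁ hne hI₁ (hQ _ hs) hI₂ ha hl hm

/-! ### Soundness for runs of the whole program -/

theorem onThread_glued {Φ : Tid → Set Future} (hΦ : ∀ t, ∀ f ∈ Φ t, IsLocal t f)
    (hne : ∀ t, (Φ t).Nonempty) (t : Tid) : onThread (glued Φ) t = Φ t := by
  classical
  ext f
  constructor
  · rintro ⟨_, ⟨φ, hφ, rfl⟩, rfl⟩
    simp only [onThread_glue fun t => hΦ t _ (hφ t)]
    exact hφ t
  · intro hf
    -- The other components are filled arbitrarily; an empty factor would make the whole product
    -- empty.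
    choose φ hφ using hne
    have hφ' : ∀ t', Function.update φ t f t' ∈ Φ t' := by
      intro t'
      obtain rfl | h := eq_or_ne t' t
      · simpa using hf
      · simpa [Function.update_of_ne h] using hφ t'
    exact ⟨_, ⟨_, hφ', rfl⟩, by simp [onThread_glue fun t => hΦ t _ (hφ' t)]⟩

section Glue

variable {μ : CES} {a : Action} {φ : Tid → Future} {t : Tid}

/-- No order relates events of different threads, and only component `t` can carry the action, so
the other components neither block nor supply it. -/
theorem available_glue (hφ : ∀ t, IsLocal t (φ t))
    (hlab : ∀ t', t' ≠ t → ∀ e ∈ (φ t').K, μ.lab e ≠ a) :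
    Available μ a (glue φ) ↔ Available μ a (φ t) := by
  constructor
  · rintro ⟨e, ⟨t', he⟩, rfl, hmin⟩
    have ht : t' = t := by
      by_contra h
      exact hlab t' h e he rfl
    subst ht
    exact ⟨e, he, rfl, fun e' he' hne hp => hmin e' ⟨_, he'⟩ hne ⟨_, hp⟩⟩
  · rintro ⟨e, he, rfl, hmin⟩
    refine ⟨e, ⟨t, he⟩, rfl, ?_⟩
    rintro e' - hne ⟨t', hp⟩
    obtain ⟨h1, h2⟩ := (hφ t').mem_of_prec _ _ hp
    obtain rfl : t' = t := ((hφ t').fst_eq _ h2).symm.trans ((hφ t).fst_eq _ he)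
    exact hmin e' h1 hne hp

theorem glue_after (hφ : ∀ t, IsLocal t (φ t))
    (hlab : ∀ t', t' ≠ t → ∀ e ∈ (φ t').K, μ.lab e ≠ a) :
    (glue φ).after μ a = glue (Function.update φ t ((φ t).after μ a)) := by
  refine Future.ext (Set.ext fun e => ?_) ?_
  · constructor
    · rintro ⟨⟨t', he⟩, hne⟩
      refine ⟨t', ?_⟩
      obtain rfl | h := eq_or_ne t' t
      · rw [Function.update_self]
        exact ⟨he, hne⟩
      · simpa [Function.update_of_ne h] using he
    · rintro ⟨t', he⟩
      obtain rfl | h := eq_or_ne t' t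
      · have he' : e ∈ ((φ t').after μ a).K := by simpa using he
        exact ⟨⟨t', he'.1⟩, he'.2⟩
      · have he' : e ∈ (φ t').K := by simpa [Function.update_of_ne h] using he
        exact ⟨⟨t', he'⟩, hlab t' h e he'⟩
  · funext p q
    refine propext ⟨?_, ?_⟩
    · rintro ⟨⟨-, hp⟩, ⟨-, hq⟩, t', h⟩
      refine ⟨t', ?_⟩
      obtain ⟨hp', hq'⟩ := (hφ t').mem_of_prec _ _ h
      obtain rfl | ht := eq_or_ne t' t
      · rw [Function.update_self]
        exact ⟨⟨hp', hp⟩, ⟨hq', hq⟩, h⟩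
      · simpa [Function.update_of_ne ht] using h
    · rintro ⟨t', h⟩
      obtain rfl | ht := eq_or_ne t' t
      · have h' : ((φ t').after μ a).prec p q := by simpa using h
        exact ⟨⟨⟨t', h'.1.1⟩, h'.1.2⟩, ⟨⟨t', h'.2.1.1⟩, h'.2.1.2⟩, t', h'.2.2⟩
      · have h' : (φ t').prec p q := by simpa [Function.update_of_ne ht] using h
        obtain ⟨hp, hq⟩ := (hφ t').mem_of_prec _ _ h'
        exact ⟨⟨⟨t', hp⟩, hlab t' ht p hp⟩, ⟨⟨t', hq⟩, hlab t' ht q hq⟩, t', h'⟩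

/-- An action of thread `t` only affects the futures of thread `t`. -/
theorem candidates_glued {Φ : Tid → Set Future} (hΦ : ∀ t, ∀ f ∈ Φ t, IsLocal t f)
    (hlab : ∀ t', t' ≠ t → ∀ f ∈ Φ t', ∀ e ∈ f.K, μ.lab e ≠ a) :
    candidates μ a (glued Φ) = glued (Function.update Φ t (candidates μ a (Φ t))) := by
  ext f
  constructor
  · rintro ⟨_, ⟨φ, hφ, rfl⟩, hav, rfl⟩
    have hl : ∀ t', t' ≠ t → ∀ e ∈ (φ t').K, μ.lab e ≠ a := fun t' h => hlab t' h _ (hφ t')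
    have hφ' := fun t => hΦ t _ (hφ t)
    refine ⟨_, fun t' => ?_, glue_after hφ' hl⟩
    obtain rfl | h := eq_or_ne t' t
    · rw [Function.update_self, Function.update_self]
      exact ⟨_, hφ t', (available_glue hφ' hl).1 hav, rfl⟩
    · simpa [Function.update_of_ne h] using hφ t'
  · rintro ⟨ψ, hψ, rfl⟩
    -- Undoing the step in component `t` alone gives the future of the product from which `glue ψ`
    -- arises.
    obtain ⟨f, hf, hav, hft⟩ : ψ t ∈ candidates μ a (Φ t) := by simpa using hψ t
    have hφ : ∀ t', Function.update ψ t f t' ∈ Φ t' := by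
      intro t'
      obtain rfl | h := eq_or_ne t' t
      · simpa using hf
      · simpa [Function.update_of_ne h] using hψ t'
    have hl : ∀ t', t' ≠ t → ∀ e ∈ (Function.update ψ t f t').K, μ.lab e ≠ a :=
      fun t' h => hlab t' h _ (hφ t')
    have hφ' := fun t => hΦ t _ (hφ t)
    refine ⟨_, ⟨_, hφ, rfl⟩, (available_glue hφ' hl).2 (by simpa using hav), ?_⟩
    rw [glue_after hφ' hl]
    simp [← hft]

end Glue

/-- The invariant of runs: the futures are glued from futures of the single threads, at which the
assertions of the outline hold. -/
structure Invariant (V : Set Val) (Φ : Tid → Set Future) (S : Sys) : Prop where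
  atoms : ∀ t, S.Q t ⊆ prog.atomicSet t
  futures_eq : S.F = glued Φ
  nonempty : ∀ t, (Φ t).Nonempty
  isLocal : ∀ t, ∀ f ∈ Φ t, IsLocal t f
  owner_eq : ∀ t, ∀ f ∈ Φ t, ∀ e ∈ f.K, owner e.2.act.label = t
  outline : ∀ t ∈ prog.tids, outline V t (Φ t) S.c

namespace Invariant

variable {V : Set Val} {Φ : Tid → Set Future}

theorem initial (hV : {0, 1, 100} ⊆ V) {c : Config} (h : Pre c) :
    Invariant V (futures V) ⟨prog.atomicSet, c, (prog.denote V).futures⟩ where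
  atoms _ := subset_rfl
  futures_eq := futures_prog_eq_glued hV
  nonempty t := by
    rw [RNG.futures_eq hV]
    exact ⟨_, 0, hV (by simp), rfl⟩
  isLocal t f hf := by
    rw [RNG.futures_eq hV] at hf
    obtain ⟨v, -, rfl⟩ := hf
    exact isLocal_branch t v
  owner_eq t f hf e he := by
    rw [RNG.futures_eq hV] at hf
    obtain ⟨v, -, rfl⟩ := hf
    exact owner_of_mem_branch he
  outline _ ht := outline_of_pre hV h ht

theorem candidates_eq {Q : Tid → Set ACom} {c : Config} {F : Set Future}
    (h : Invariant V Φ ⟨Q, c, F⟩) {t : Tid} {s : ACom} (hs : s ∈ Q t) {a : Action}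
    {γ γ' : Tid → RegFile} (hl : LocalStep t γ s a γ') :
    candidates (prog.denote V) a F =
      glued (Function.update Φ t (candidates (prog.denote V) a (Φ t))) := by
  obtain rfl : F = glued Φ := h.futures_eq
  refine candidates_glued h.isLocal fun t' hne f hf e he hlab => hne ?_
  rw [← h.owner_eq t' f hf e he, ← owner_of_mem_atomicSet (h.atoms t hs), ← hl.label_eq, ← hlab]
  rfl

theorem candidates_nonempty {Q : Tid → Set ACom} {c : Config} {F : Set Future}
    (h : Invariant V Φ ⟨Q, c, F⟩) {t : Tid} {s : ACom} (hs : s ∈ Q t) {a : Action}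
    {γ γ' : Tid → RegFile} (hl : LocalStep t γ s a γ')
    (ha : (candidates (prog.denote V) a F).Nonempty) :
    (candidates (prog.denote V) a (Φ t)).Nonempty := by
  rw [h.candidates_eq hs hl] at ha
  obtain ⟨_, φ, hφ, -⟩ := ha
  exact ⟨φ t, by simpa using hφ t⟩

/-- Only the factor of the acting thread changes: its assertions persist by local correctness, those
of the other threads by global correctness. -/
theorem step (hV : {0, 1, 100} ⊆ V) {S S' : Sys} (h : Invariant V Φ S)
    (hstep : Step (prog.denote V) S S') : ∃ Φ', Invariant V Φ' S' := by
  obtain ⟨t, s, hstep⟩ := hstep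
  cases hstep with
  | mk Q σ σ' γ γ' F g a hs ha hl hm =>
    have ha' := h.candidates_nonempty hs hl ha
    have hs' := h.atoms t hs
    refine ⟨Function.update Φ t (candidates (prog.denote V) a (Φ t)), fun t' => ?_,
      h.candidates_eq hs hl, fun t' => ?_, fun t' f hf => ?_, fun t' f hf e he => ?_,
      fun t' ht' => ?_⟩ <;> obtain rfl | hne := eq_or_ne t' t
    · simp only [Function.update_self]
      exact Set.sdiff_subset.trans (h.atoms t')
    · simpa [Function.update_of_ne hne] using h.atoms t'
    · simpa using ha'
    · simpa [Function.update_of_ne hne] using h.nonempty t'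
    · obtain ⟨f', hf', -, rfl⟩ : f ∈ candidates (prog.denote V) a (Φ t') := by simpa using hf
      exact ⟨fun e he => (h.isLocal t' f' hf').fst_eq e he.1, fun _ _ h => ⟨h.1, h.2.1⟩⟩
    · exact h.isLocal t' f (by simpa [Function.update_of_ne hne] using hf)
    · obtain ⟨f', hf', -, rfl⟩ : f ∈ candidates (prog.denote V) a (Φ t') := by simpa using hf
      exact h.owner_eq t' f' hf' e he.1
    · exact h.owner_eq t' f (by simpa [Function.update_of_ne hne] using hf) e he
    · simpa using outline_step_self hV hs' (h.outline t' ht') ha' hl hm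
    · simpa [Function.update_of_ne hne] using outline_step_other hV ht' hne (h.outline t' ht') hs'
        (h.outline t (mem_tids_of_atomicSet hs')) ha' hl hm

theorem of_run (hV : {0, 1, 100} ⊆ V) {c : Config} (h : Pre c) {S : Sys}
    (hrun : Relation.ReflTransGen (Step (prog.denote V))
      ⟨prog.atomicSet, c, (prog.denote V).futures⟩ S) : ∃ Φ, Invariant V Φ S := by
  induction hrun with
  | refl => exact ⟨_, initial hV h⟩
  | tail _ hstep ih =>
    obtain ⟨Φ, hΦ⟩ := ih
    exact hΦ.step hV hstep

theorem post (hV : {0, 1, 100} ⊆ V) {S : Sys} (h : Invariant V Φ S) : Post S.c :=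
  post_of_outline hV (h.outline 3 three_mem)

/-- Under the invariant the only step open to thread 3 is its read, after which no event of it
remains. -/
theorem not_step_line6 (hV : {0, 1, 100} ⊆ V) {S S' : Sys} (h : Invariant V Φ S) :
    ¬ FutureStep (prog.denote V) 3 line6 S S' := by
  intro hstep
  cases hstep with
  | mk Q σ σ' γ γ' F g a hs ha hl hm =>
    obtain ⟨_, -, -, -, hne, -⟩ := step_three hV (h.atoms 3 hs) (h.outline 3 three_mem)
      (h.candidates_nonempty hs hl ha) hl hm
    exact hne rfl

end Invariant

end RNG

end MRD

open MRD MRD.RNG in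
theorem mainTheorem4 (V : Set Val) (hV : {0, 1, 100} ⊆ V) :
    -- the futures of the three threads
    (futures V 1 = {f | ∃ v ∈ V, f = chain 1 (.rd false 1 x v) (.wr false 2 y (v + 1))} ∧
     futures V 2 = {f | ∃ v ∈ V, f = chain 2 (.rd false 3 y v) (.wr false 4 x v)} ∧
     futures V 3 = {f | (∃ v ∈ V, v ≠ 100 ∧ f = single 3 (.rd false 5 x v)) ∨
        f = chain 3 (.rd false 5 x 100) (.wr false 6 x 99)}) ∧
    -- the proof outline is valid
    OutlineValid V Init Pre prog (outline V) Post ∧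
    -- the program satisfies its postcondition
    HoareTriple V Init Pre prog Post ∧
    -- in every reachable state the assertions of the outline hold, no thread can observe
    -- `x = 99`, and the guarded write cannot be executed
    ∀ S, Reachable V S →
      (∀ t ∈ prog.tids, outline V t (onThread S.F t) S.c) ∧ Post S.c ∧
      ∀ S', ¬ FutureStep (prog.denote V) 3 line6 S S' := by
  refine ⟨⟨futures_one hV, futures_two hV, futures_three hV⟩, outlineValid hV,
    ⟨fun _ => pre_of_init, fun c Q' c' F' _ hpre hrun _ => ?_⟩, ?_⟩
  · obtain ⟨Φ, hΦ⟩ := Invariant.of_run hV hpre hrun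
    exact hΦ.post hV
  · rintro S ⟨c, hinit, hrun⟩
    obtain ⟨Φ, hΦ⟩ := Invariant.of_run hV (pre_of_init hinit) hrun
    refine ⟨fun t ht => ?_, hΦ.post hV, fun S' => hΦ.not_step_line6 hV⟩
    -- Restricting the glued futures to thread `t` returns the factor at which the invariant states
    -- the assertions.
    rw [hΦ.futures_eq, onThread_glued hΦ.isLocal hΦ.nonempty]
    exact hΦ.outline t ht
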